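/- Let $(\overline M,\overline g)$ be a semi-Riemannian manifold of constant sectional curvature $c\in\mathbb R$, with Levi-Civita connection $\overline\nabla$. Let $M$ be a lightlike hypersurface of $\overline M$, i.e. a manifold with $\dim \overline M=\dim M+1$, immersed in $\overline M$, such that $\mathrm{Rad}\,TM=TM\cap TM^{\perp}$ is a smooth distribution of rank one. Let $g$ be the induced (degenerate) metric and let $S(TM)$ be a screen distribution, i.e. a smooth distribution on $M$ with $TM=\mathrm{Rad}\,TM\oplus S(TM)$. Let $tr(TM)$ be the associated lightlike transversal line bundle, spanned locally by the null vector field $N$ orthogonal to $S(TM)$ with $\overline g(N,\xi)=1$ for a local nowhere zero section $\xi$ of $\mathrm{Rad}\,TM$; then $T\overline M|_M=TM\oplus tr(TM)$. The induced connection $\nabla$ and the second fundamental form $h$ of $(M,g,S(TM))$ are defined by $$\overline\nabla_XY=\nabla_XY+h(X,Y),\qquad \nabla_XY\in\Gamma(TM),\quad h(X,Y)\in\Gamma(tr(TM)),\qquad X,Y\in\Gamma(TM),$$ and $R(X,Y)Z=\nabla_X\nabla_YZ-\nabla_Y\nabla_XZ-\nabla_{[X,Y]}Z$ is the curvature tensor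 of $\nabla$. Call $M$ totally geodesic if $h=0$, and call $(M,g,S(TM))$ locally symmetric if for all $W,X,Y,Z\in\Gamma(TM)$, $T\in\Gamma(S(TM))$ and $N\in\Gamma(tr(TM))$ $$g\big((\nabla_WR)(X,Y)Z,T\big)=0\quad\text{and}\quad \overline g\big((\nabla_WR)(X,Y)Z,N\big)=0 .$$ If $M$ is totally geodesic, then $(M,g,S(TM))$ is locally symmetric. If $c\neq 0$, then $(M,g,S(TM))$ is locally symmetric if and only if $M$ is totally geodesic. -/

import Mathlib

open scoped Manifold ContDiff Bundle
open Bundle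

noncomputable section

namespace Lightlike

/-! ### Vector fields, distributions, curvature

All manifolds are finite-dimensional, smooth, Hausdorff, second countable and without boundary. A
vector field on `M` is a function `X : Π p, TangentSpace 𝓘(ℝ, E) p`. -/

section General

variable {E : Type*} [NormedAddCommGroup E] [NormedSpace ℝ E]
  {M : Type*} [TopologicalSpace M] [ChartedSpace E M] [IsManifold 𝓘(ℝ, E) ∞ M]

/-- `X` is a smooth vector field, `X ∈ Γ(TM)`. -/
def IsSmoothVF (X : Π p : M, TangentSpace 𝓘(ℝ, E) p) : Prop :=
  ContMDiff 𝓘(ℝ, E) 𝓘(ℝ, E).tangent ∞ (fun p ↦ (⟨p, X p⟩ : TangentBundle 𝓘(ℝ, E) M))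

/-- `S` is a smooth distribution of rank `k`: around each point it is spanned by `k` pointwise
linearly independent smooth local vector fields. -/
def IsSmoothDistribution (k : ℕ) (S : Π p : M, Submodule ℝ (TangentSpace 𝓘(ℝ, E) p)) : Prop :=
  ∀ p : M, ∃ U : Set M, IsOpen U ∧ p ∈ U ∧
    ∃ s : Fin k → Π q : M, TangentSpace 𝓘(ℝ, E) q,
      (∀ j, ContMDiffOn 𝓘(ℝ, E) 𝓘(ℝ, E).tangent ∞
        (fun q ↦ (⟨q, s j q⟩ : TangentBundle 𝓘(ℝ, E) M)) U) ∧
      ∀ q ∈ U, LinearIndependent ℝ (fun j ↦ s j q) ∧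
        Submodule.span ℝ (Set.range fun j ↦ s j q) = S q

/-- The curvature `R(X,Y)Z = ∇_X ∇_Y Z - ∇_Y ∇_X Z - ∇_[X,Y] Z` of a connection on the tangent
bundle, where `∇ Z p v` stands for `(∇_v Z)(p)`. -/
def curvature
    (nab : (Π p : M, TangentSpace 𝓘(ℝ, E) p) →
      Π p : M, TangentSpace 𝓘(ℝ, E) p → TangentSpace 𝓘(ℝ, E) p)
    (X Y Z : Π p : M, TangentSpace 𝓘(ℝ, E) p) (p : M) : TangentSpace 𝓘(ℝ, E) p :=
  nab (fun q ↦ nab Z q (Y q)) p (X p) - nab (fun q ↦ nab Z q (X q)) p (Y p)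
    - nab Z p (VectorField.mlieBracket 𝓘(ℝ, E) X Y p)

/-- The covariant derivative of the curvature tensor of a connection,
`(∇_W R)(X,Y)Z = ∇_W (R(X,Y)Z) - R(∇_W X,Y)Z - R(X,∇_W Y)Z - R(X,Y)∇_W Z`. -/
def covDerivCurvature
    (nab : (Π p : M, TangentSpace 𝓘(ℝ, E) p) →
      Π p : M, TangentSpace 𝓘(ℝ, E) p → TangentSpace 𝓘(ℝ, E) p)
    (W X Y Z : Π p : M, TangentSpace 𝓘(ℝ, E) p) (p : M) : TangentSpace 𝓘(ℝ, E) p :=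
  nab (curvature nab X Y Z) p (W p)
    - curvature nab (fun q ↦ nab X q (W q)) Y Z p
    - curvature nab X (fun q ↦ nab Y q (W q)) Z p
    - curvature nab X Y (fun q ↦ nab Z q (W q)) p

end General

/-! ### Semi-Riemannian manifolds -/

section SemiRiemannian

variable {E' : Type*} [NormedAddCommGroup E'] [NormedSpace ℝ E']
  {N : Type*} [TopologicalSpace N] [ChartedSpace E' N] [IsManifold 𝓘(ℝ, E') ∞ N]

variable (E' N) in
/-- A semi-Riemannian metric on `N`: a smooth field of nondegenerate symmetric bilinear forms of
constant index. -/
structure SemiRiemannianMetric where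
  /-- the scalar product on each tangent space -/
  val (x : N) : TangentSpace 𝓘(ℝ, E') x →L[ℝ] TangentSpace 𝓘(ℝ, E') x →L[ℝ] ℝ
  symm (x : N) (v w : TangentSpace 𝓘(ℝ, E') x) : val x v w = val x w v
  nondegenerate (x : N) (v : TangentSpace 𝓘(ℝ, E') x) : (∀ w, val x v w = 0) → v = 0
  contMDiff : ContMDiff 𝓘(ℝ, E') (𝓘(ℝ, E').prod 𝓘(ℝ, E' →L[ℝ] E' →L[ℝ] ℝ)) ∞
    (fun x ↦ TotalSpace.mk' (E' →L[ℝ] E' →L[ℝ] ℝ)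
      (E := fun x : N ↦ TangentSpace 𝓘(ℝ, E') x →L[ℝ] TangentSpace 𝓘(ℝ, E') x →L[ℝ] ℝ)
      x (val x))
  /-- the index: the largest dimension of a negative definite subspace of a tangent space -/
  index : ℕ
  isGreatest_index (x : N) :
    IsGreatest {k | ∃ W : Submodule ℝ (TangentSpace 𝓘(ℝ, E') x),
      Module.finrank ℝ W = k ∧ ∀ w ∈ W, w ≠ 0 → val x w w < 0} index

/-- The connection `D` on `TN` is the Levi-Civita connection of `g`: it is smooth, compatible with
the metric, `v(g(Y,Z)) = g(∇_v Y,Z) + g(Y,∇_v Z)`, and torsion-free. Here `D Y x v` is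
`(∇_v Y)(x)`. -/
structure SemiRiemannianMetric.IsLeviCivita (g : SemiRiemannianMetric E' N)
    (D : CovariantDerivative 𝓘(ℝ, E') E' (TangentSpace 𝓘(ℝ, E') : N → Type _)) : Prop where
  smooth : ContMDiffCovariantDerivativeOn E' ∞ D.toFun Set.univ
  metric (Y Z : Π x : N, TangentSpace 𝓘(ℝ, E') x) (x : N) (v : TangentSpace 𝓘(ℝ, E') x)
    (hY : MDifferentiableAt 𝓘(ℝ, E') 𝓘(ℝ, E').tangent
      (fun y ↦ (⟨y, Y y⟩ : TangentBundle 𝓘(ℝ, E') N)) x)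
    (hZ : MDifferentiableAt 𝓘(ℝ, E') 𝓘(ℝ, E').tangent
      (fun y ↦ (⟨y, Z y⟩ : TangentBundle 𝓘(ℝ, E') N)) x) :
    mvfderiv 𝓘(ℝ, E') (fun y ↦ g.val y (Y y) (Z y)) x v
      = g.val x (D Y x v) (Z x) + g.val x (Y x) (D Z x v)
  torsion_free (X Y : Π x : N, TangentSpace 𝓘(ℝ, E') x) (x : N)
    (hX : MDifferentiableAt 𝓘(ℝ, E') 𝓘(ℝ, E').tangent
      (fun y ↦ (⟨y, X y⟩ : TangentBundle 𝓘(ℝ, E') N)) x)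
    (hY : MDifferentiableAt 𝓘(ℝ, E') 𝓘(ℝ, E').tangent
      (fun y ↦ (⟨y, Y y⟩ : TangentBundle 𝓘(ℝ, E') N)) x) :
    D Y x (X x) - D X x (Y x) = VectorField.mlieBracket 𝓘(ℝ, E') X Y x

/-- `(N, g)`, with Levi-Civita connection `D`, has constant sectional curvature `c`: every
nondegenerate tangent plane, spanned by `X` and `Y` say, has sectional curvature
`g(R(X,Y)Y,X) / (g(X,X) g(Y,Y) - g(X,Y)²) = c`. -/
def SemiRiemannianMetric.HasConstantSectionalCurvature (g : SemiRiemannianMetric E' N)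
    (D : CovariantDerivative 𝓘(ℝ, E') E' (TangentSpace 𝓘(ℝ, E') : N → Type _)) (c : ℝ) : Prop :=
  ∀ X Y : Π x : N, TangentSpace 𝓘(ℝ, E') x, IsSmoothVF X → IsSmoothVF Y → ∀ x : N,
    g.val x (X x) (X x) * g.val x (Y x) (Y x) - g.val x (X x) (Y x) ^ 2 ≠ 0 →
    g.val x (curvature (fun Z y v ↦ D Z y v) X Y Y x) (X x)
        / (g.val x (X x) (X x) * g.val x (Y x) (Y x) - g.val x (X x) (Y x) ^ 2) = c

end SemiRiemannian

/-! ### Lightlike hypersurfaces and their induced objects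

A hypersurface of `N` is a manifold `M` with `dim N = dim M + 1` and an immersion `i : M → N`. -/

section Hypersurface

variable {E : Type*} [NormedAddCommGroup E] [NormedSpace ℝ E]
  {M : Type*} [TopologicalSpace M] [ChartedSpace E M] [IsManifold 𝓘(ℝ, E) ∞ M]
  {E' : Type*} [NormedAddCommGroup E'] [NormedSpace ℝ E'] [FiniteDimensional ℝ E']
  {N : Type*} [TopologicalSpace N] [ChartedSpace E' N] [IsManifold 𝓘(ℝ, E') ∞ N]

/-- The differential `T_p M → T_{i p} N` of `i`. -/
def diff (i : M → N) (p : M) : TangentSpace 𝓘(ℝ, E) p →L[ℝ] TangentSpace 𝓘(ℝ, E') (i p) :=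
  mfderiv 𝓘(ℝ, E) 𝓘(ℝ, E') i p

/-- The (possibly degenerate) metric on `M` induced by `g` through `i`. -/
def inducedMetric (g : SemiRiemannianMetric E' N) (i : M → N) (p : M)
    (v w : TangentSpace 𝓘(ℝ, E) p) : ℝ :=
  g.val (i p) (diff i p v) (diff i p w)

/-- The radical `Rad T_p M = T_p M ∩ (T_p M)^⊥` of the induced metric. -/
def radical (g : SemiRiemannianMetric E' N) (i : M → N) (p : M) :
    Submodule ℝ (TangentSpace 𝓘(ℝ, E) p) where
  carrier := {v | ∀ w, inducedMetric g i p v w = 0}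
  add_mem' {a b} ha hb w := by
    have h1 := ha w
    have h2 := hb w
    simp only [inducedMetric] at h1 h2 ⊢
    simp [h1, h2]
  zero_mem' w := by simp [inducedMetric]
  smul_mem' t a ha w := by
    have h1 := ha w
    simp only [inducedMetric] at h1 ⊢
    simp [h1]

/-- `i : M → N` is a lightlike hypersurface of `(N, g)`: an immersion of codimension one such that
`Rad TM` is a smooth distribution of rank one. -/
structure IsLightlikeHypersurface (g : SemiRiemannianMetric E' N) (i : M → N) : Prop where
  contMDiff : ContMDiff 𝓘(ℝ, E) 𝓘(ℝ, E') ∞ i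
  injective (p : M) : Function.Injective (diff (E := E) (E' := E') i p)
  codim : Module.finrank ℝ E' = Module.finrank ℝ E + 1
  radical : IsSmoothDistribution 1 (radical (E := E) g i)

/-- A screen distribution `S(TM)`: a smooth distribution complementary to `Rad TM` in `TM`. The
induced metric is automatically nondegenerate on it. -/
structure ScreenDistribution (g : SemiRiemannianMetric E' N) (i : M → N) where
  /-- the fibre of `S(TM)` over a point -/
  fiber (p : M) : Submodule ℝ (TangentSpace 𝓘(ℝ, E) p)
  smooth : IsSmoothDistribution (Module.finrank ℝ E - 1) fiber
  isCompl (p : M) : IsCompl (radical g i p) (fiber p)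

/-- The fibre over `p` of the lightlike transversal bundle `tr(TM)` determined by the screen: the
line spanned by the null vectors `n` orthogonal to `S(TM)` with `g(n, ξ) = 1` for some `ξ` in
`Rad TM`. -/
def transversal (g : SemiRiemannianMetric E' N) (i : M → N)
    (S : ScreenDistribution (E := E) g i) (p : M) : Submodule ℝ (TangentSpace 𝓘(ℝ, E') (i p)) :=
  Submodule.span ℝ {n | g.val (i p) n n = 0 ∧ (∀ w ∈ S.fiber p, g.val (i p) n (diff i p w) = 0) ∧
    ∃ ξ ∈ radical (E := E) g i p, g.val (i p) n (diff i p ξ) = 1}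

open Classical in
/-- The component in `T_p M` of a vector of `T_{i p} N = di(T_p M) ⊕ tr(TM)_p`. -/
def tangentPart (g : SemiRiemannianMetric E' N) (i : M → N)
    (S : ScreenDistribution (E := E) g i) (p : M) (v : TangentSpace 𝓘(ℝ, E') (i p)) :
    TangentSpace 𝓘(ℝ, E) p :=
  if h : ∃ u : TangentSpace 𝓘(ℝ, E) p, v - diff i p u ∈ transversal g i S p then h.choose else 0

/-- The covariant derivative along `i` (the pullback connection on `i*TN`) of a vector field `V`
along `i`, in the direction `u ∈ T_p M`. If `V = ∑ⱼ Vʲ (sⱼ ∘ i)` near `p` for a local frame `sⱼ` of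
`TN` around `i p`, it equals `∑ⱼ (u(Vʲ) sⱼ + Vʲ ∇_{di(u)} sⱼ)` at `p`, which does not depend on the
frame; we take a coordinate frame around `i p`. -/
def covAlong (D : CovariantDerivative 𝓘(ℝ, E') E' (TangentSpace 𝓘(ℝ, E') : N → Type _)) (i : M → N)
    (V : Π p : M, TangentSpace 𝓘(ℝ, E') (i p)) (p : M) (u : TangentSpace 𝓘(ℝ, E) p) :
    TangentSpace 𝓘(ℝ, E') (i p) :=
  let e := trivializationAt E' (TangentSpace 𝓘(ℝ, E') : N → Type _) (i p)
  let b := Module.finBasis ℝ E'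
  ∑ j, (mvfderiv 𝓘(ℝ, E) (fun q ↦ e.localFrameCoeff 𝓘(ℝ, E') b j (i q) (V q)) p u
          • e.localFrame b j (i p)
        + e.localFrameCoeff 𝓘(ℝ, E') b j (i p) (V p) • D (e.localFrame b j) (i p) (diff i p u))

/-- The induced connection `∇` on `M`: the tangential part in the Gauss formula
`∇̄_u Y = ∇_u Y + h(u, Y)`. -/
def inducedConnection (g : SemiRiemannianMetric E' N)
    (D : CovariantDerivative 𝓘(ℝ, E') E' (TangentSpace 𝓘(ℝ, E') : N → Type _)) (i : M → N)
    (S : ScreenDistribution (E := E) g i)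
    (Y : Π p : M, TangentSpace 𝓘(ℝ, E) p) (p : M) (u : TangentSpace 𝓘(ℝ, E) p) :
    TangentSpace 𝓘(ℝ, E) p :=
  tangentPart g i S p (covAlong D i (fun q ↦ diff i q (Y q)) p u)

/-- The second fundamental form `h(X, Y) = ∇̄_X Y - ∇_X Y`, with values in `tr(TM)`. -/
def secondFundamentalForm (g : SemiRiemannianMetric E' N)
    (D : CovariantDerivative 𝓘(ℝ, E') E' (TangentSpace 𝓘(ℝ, E') : N → Type _)) (i : M → N)
    (S : ScreenDistribution (E := E) g i)
    (X Y : Π p : M, TangentSpace 𝓘(ℝ, E) p) (p : M) : TangentSpace 𝓘(ℝ, E') (i p) :=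
  covAlong D i (fun q ↦ diff i q (Y q)) p (X p) - diff i p (inducedConnection g D i S Y p (X p))

/-- `M` is totally geodesic: its second fundamental form vanishes. -/
def IsTotallyGeodesic (g : SemiRiemannianMetric E' N)
    (D : CovariantDerivative 𝓘(ℝ, E') E' (TangentSpace 𝓘(ℝ, E') : N → Type _)) (i : M → N)
    (S : ScreenDistribution (E := E) g i) : Prop :=
  ∀ X Y : Π p : M, TangentSpace 𝓘(ℝ, E) p, IsSmoothVF X → IsSmoothVF Y →
    ∀ p : M, secondFundamentalForm g D i S X Y p = 0

/-- `(M, g, S(TM))` is locally symmetric: the covariant derivative with respect to the induced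
connection `∇` of its curvature `R` satisfies `g((∇_W R)(X,Y)Z, T) = 0` for all `T` in `S(TM)` and
`ḡ((∇_W R)(X,Y)Z, n) = 0` for all `n` in `tr(TM)`. -/
def IsLocallySymmetric (g : SemiRiemannianMetric E' N)
    (D : CovariantDerivative 𝓘(ℝ, E') E' (TangentSpace 𝓘(ℝ, E') : N → Type _)) (i : M → N)
    (S : ScreenDistribution (E := E) g i) : Prop :=
  ∀ W X Y Z : Π p : M, TangentSpace 𝓘(ℝ, E) p,
    IsSmoothVF W → IsSmoothVF X → IsSmoothVF Y → IsSmoothVF Z → ∀ p : M,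
      (∀ t ∈ S.fiber p,
        inducedMetric g i p (covDerivCurvature (inducedConnection g D i S) W X Y Z p) t = 0) ∧
      ∀ n ∈ transversal g i S p,
        g.val (i p) (diff i p (covDerivCurvature (inducedConnection g D i S) W X Y Z p)) n = 0

end Hypersurface

end Lightlike

end

/-! In constant curvature `c` the curvature of the ambient connection is
`R̄(X, Y)Z = c (g(Y, Z) X - g(X, Z) Y)`. If `h = 0`, then `∇` is the restriction of `∇̄`: it is
compatible with the induced metric and has curvature of the same form, so `∇R = 0`. Conversely,
for a local section `ξ` of `Rad TM` the second fundamental form is `h(W, Y) = -g(Y, ∇_W ξ) N`,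
while `R(·, ·)ξ = 0`, so that `(∇_W R)(ξ, Y)ξ = -R(ξ, Y)∇_W ξ`, whose pairing with `N` is
`-c g(Y, ∇_W ξ)`. -/

namespace Lightlike

open Filter Topology

/-! ### Vector fields along a map -/

section Along

variable {E : Type*} [NormedAddCommGroup E] [NormedSpace ℝ E]
  {M : Type*} [TopologicalSpace M] [ChartedSpace E M]
  {E' : Type*} [NormedAddCommGroup E'] [NormedSpace ℝ E']
  {N : Type*} [TopologicalSpace N] [ChartedSpace E' N]

lemma exists_contMDiff_eventually_eq_one [FiniteDimensional ℝ E] [T2Space M]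
    [IsManifold 𝓘(ℝ, E) ∞ M] {p : M} {U : Set M} (hU : U ∈ 𝓝 p) :
    ∃ χ : M → ℝ, ContMDiff 𝓘(ℝ, E) 𝓘(ℝ) ∞ χ ∧ (∀ᶠ q in 𝓝 p, χ q = 1) ∧ tsupport χ ⊆ U := by
  obtain ⟨χ, hχ⟩ := (SmoothBumpFunction.nhds_basis_support (I := 𝓘(ℝ, E)) hU).ex_mem
  exact ⟨χ, χ.contMDiff, χ.eventuallyEq_one, hχ⟩

lemma contMDiff_mul_of_tsupport {χ f : M → ℝ} (hχ : ContMDiff 𝓘(ℝ, E) 𝓘(ℝ) ∞ χ)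
    (hf : ∀ q ∈ tsupport χ, ContMDiffAt 𝓘(ℝ, E) 𝓘(ℝ) ∞ f q) :
    ContMDiff 𝓘(ℝ, E) 𝓘(ℝ) ∞ (fun q ↦ χ q * f q) :=
  contMDiff_of_tsupport fun q hq ↦ (hχ q).mul (hf q (tsupport_mul_subset_left hq))

variable [IsManifold 𝓘(ℝ, E') ∞ N]

variable (E) in
/-- Smoothness at `p` of a vector field `V` along the map `i : M → N`. -/
def SmoothAlongAt (i : M → N) (V : Π p : M, TangentSpace 𝓘(ℝ, E') (i p)) (p : M) : Prop :=
  ContMDiffAt 𝓘(ℝ, E) 𝓘(ℝ, E').tangent ∞ (fun q ↦ (⟨i q, V q⟩ : TangentBundle 𝓘(ℝ, E') N)) p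

variable (E) in
/-- Smoothness of a vector field along the map `i : M → N`, i.e. of a section of `i*TN`. -/
def SmoothAlong (i : M → N) (V : Π p : M, TangentSpace 𝓘(ℝ, E') (i p)) : Prop :=
  ∀ p, SmoothAlongAt E i V p

variable {i : M → N} {V W : Π p : M, TangentSpace 𝓘(ℝ, E') (i p)} {p : M}

lemma SmoothAlongAt.contMDiffAt_base (hV : SmoothAlongAt E i V p) :
    ContMDiffAt 𝓘(ℝ, E) 𝓘(ℝ, E') ∞ i p :=
  (contMDiffAt_totalSpace.1 hV).1

lemma smoothAlongAt_iff (hi : ContMDiffAt 𝓘(ℝ, E) 𝓘(ℝ, E') ∞ i p) :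
    SmoothAlongAt E i V p ↔ ContMDiffAt 𝓘(ℝ, E) 𝓘(ℝ, E') ∞ (fun q ↦
      (trivializationAt E' (TangentSpace 𝓘(ℝ, E') : N → Type _) (i p) ⟨i q, V q⟩).2) p :=
  contMDiffAt_totalSpace.trans (and_iff_right hi)

variable (E') in
lemma eventually_mem_trivializationAt_baseSet (hi : ContinuousAt i p) :
    ∀ᶠ q in 𝓝 p, i q ∈
      (trivializationAt E' (TangentSpace 𝓘(ℝ, E') : N → Type _) (i p)).baseSet :=
  hi.preimage_mem_nhds ((Trivialization.open_baseSet _).mem_nhds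
    (mem_baseSet_trivializationAt E' (TangentSpace 𝓘(ℝ, E') : N → Type _) (i p)))

lemma SmoothAlongAt.congr (hV : SmoothAlongAt E i V p) (h : ∀ᶠ q in 𝓝 p, W q = V q) :
    SmoothAlongAt E i W p :=
  ContMDiffAt.congr_of_eventuallyEq hV (h.mono fun q hq ↦ by simp only [hq])

lemma SmoothAlongAt.add (hV : SmoothAlongAt E i V p) (hW : SmoothAlongAt E i W p) :
    SmoothAlongAt E i (fun q ↦ V q + W q) p := by
  have hi := hV.contMDiffAt_base
  rw [smoothAlongAt_iff hi] at hV hW ⊢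
  refine (hV.add hW).congr_of_eventuallyEq ?_
  filter_upwards [eventually_mem_trivializationAt_baseSet E' hi.continuousAt] with q hq
  exact (Trivialization.linear ℝ _ hq).map_add _ _

lemma SmoothAlongAt.smul {f : M → ℝ} (hf : ContMDiffAt 𝓘(ℝ, E) 𝓘(ℝ) ∞ f p)
    (hV : SmoothAlongAt E i V p) : SmoothAlongAt E i (fun q ↦ f q • V q) p := by
  have hi := hV.contMDiffAt_base
  rw [smoothAlongAt_iff hi] at hV ⊢
  refine (hf.smul hV).congr_of_eventuallyEq ?_
  filter_upwards [eventually_mem_trivializationAt_baseSet E' hi.continuousAt] with q hq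
  exact (Trivialization.linear ℝ _ hq).map_smul _ _

lemma smoothAlongAt_zero (hi : ContMDiffAt 𝓘(ℝ, E) 𝓘(ℝ, E') ∞ i p) :
    SmoothAlongAt E i (fun q ↦ (0 : TangentSpace 𝓘(ℝ, E') (i q))) p := by
  rw [smoothAlongAt_iff hi]
  refine (contMDiffAt_const (c := (0 : E'))).congr_of_eventuallyEq ?_
  filter_upwards [eventually_mem_trivializationAt_baseSet E' hi.continuousAt] with q hq
  exact (Trivialization.linear ℝ _ hq).map_zero

lemma SmoothAlongAt.sum {ι : Type*} {s : Finset ι} {V : ι → Π p : M, TangentSpace 𝓘(ℝ, E') (i p)}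
    (hi : ContMDiffAt 𝓘(ℝ, E) 𝓘(ℝ, E') ∞ i p) (hV : ∀ j ∈ s, SmoothAlongAt E i (V j) p) :
    SmoothAlongAt E i (fun q ↦ ∑ j ∈ s, V j q) p := by
  classical
  induction s using Finset.induction_on with
  | empty => simpa only [Finset.sum_empty] using smoothAlongAt_zero hi
  | insert a s ha ih =>
    simp only [Finset.sum_insert ha]
    exact (hV a (Finset.mem_insert_self a s)).add
      (ih fun j hj ↦ hV j (Finset.mem_insert_of_mem hj))

lemma SmoothAlongAt.sub (hV : SmoothAlongAt E i V p) (hW : SmoothAlongAt E i W p) :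
    SmoothAlongAt E i (fun q ↦ V q - W q) p :=
  (hV.add (hW.smul (f := fun _ ↦ -1) contMDiffAt_const)).congr
    (Eventually.of_forall fun q ↦ by rw [neg_one_smul, sub_eq_add_neg])

lemma SmoothAlongAt.comp {s : Π x : N, TangentSpace 𝓘(ℝ, E') x} (hs : SmoothAlongAt E' id s (i p))
    (hi : ContMDiffAt 𝓘(ℝ, E) 𝓘(ℝ, E') ∞ i p) : SmoothAlongAt E i (fun q ↦ s (i q)) p :=
  ContMDiffAt.comp p (g := fun x ↦ (⟨x, s x⟩ : TangentBundle 𝓘(ℝ, E') N)) hs hi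

lemma IsSmoothVF.smoothAlong_comp {s : Π x : N, TangentSpace 𝓘(ℝ, E') x} (hs : IsSmoothVF s)
    (hi : ContMDiff 𝓘(ℝ, E) 𝓘(ℝ, E') ∞ i) : SmoothAlong E i (fun q ↦ s (i q)) :=
  fun p ↦ SmoothAlongAt.comp (hs (i p)) (hi p)

lemma smoothAlong_smul_of_tsupport {χ : M → ℝ} (hi : ContMDiff 𝓘(ℝ, E) 𝓘(ℝ, E') ∞ i)
    (hχ : ContMDiff 𝓘(ℝ, E) 𝓘(ℝ) ∞ χ) (hV : ∀ q ∈ tsupport χ, SmoothAlongAt E i V q) :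
    SmoothAlong E i (fun q ↦ χ q • V q) := by
  intro q
  by_cases hq : q ∈ tsupport χ
  · exact (hV q hq).smul (hχ q)
  · refine (smoothAlongAt_zero (hi q)).congr ?_
    filter_upwards [(isClosed_tsupport χ).isOpen_compl.mem_nhds hq] with x hx
    rw [image_eq_zero_of_notMem_tsupport hx, zero_smul]

lemma SmoothAlongAt.localFrameCoeff [FiniteDimensional ℝ E'] (hV : SmoothAlongAt E i V p)
    (e : Trivialization E' (TotalSpace.proj : TangentBundle 𝓘(ℝ, E') N → N))
    [MemTrivializationAtlas e] (hp : i p ∈ e.baseSet) {ι : Type*} (b : Module.Basis ι ℝ E')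
    (j : ι) :
    ContMDiffAt 𝓘(ℝ, E) 𝓘(ℝ) ∞ (fun q ↦ e.localFrameCoeff 𝓘(ℝ, E') b j (i q) (V q)) p := by
  have hVe : ContMDiffAt 𝓘(ℝ, E) 𝓘(ℝ, E') ∞ (fun q ↦ (e ⟨i q, V q⟩).2) p :=
    ((e.contMDiffAt_iff (by simpa only [e.mem_source] using hp)).1 hV).2
  have hcoord : ContMDiffAt 𝓘(ℝ, E) 𝓘(ℝ) ∞
      (fun q ↦ LinearMap.toContinuousLinearMap (b.coord j) (e ⟨i q, V q⟩).2) p :=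
    (ContinuousLinearMap.contMDiff _).contMDiffAt.comp p hVe
  refine hcoord.congr_of_eventuallyEq ?_
  filter_upwards [hV.contMDiffAt_base.continuousAt.preimage_mem_nhds
    (e.open_baseSet.mem_nhds hp)] with q hq
  classical
  simpa using e.localFrameCoeff_eq_coeff (I := 𝓘(ℝ, E')) (b := b) hq (i := j)
    (s := Function.update 0 (i q) (V q))

lemma exists_isSmoothVF_frame [FiniteDimensional ℝ E'] [T2Space N]
    (hi : ContMDiff 𝓘(ℝ, E) 𝓘(ℝ, E') ∞ i) (p : M) :
    ∃ s : Fin (Module.finrank ℝ E') → Π x : N, TangentSpace 𝓘(ℝ, E') x,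
      (∀ j, IsSmoothVF (s j)) ∧
      ∀ V : Π p : M, TangentSpace 𝓘(ℝ, E') (i p), SmoothAlong E i V →
        ∃ f : Fin (Module.finrank ℝ E') → M → ℝ, (∀ j, ContMDiff 𝓘(ℝ, E) 𝓘(ℝ) ∞ (f j)) ∧
          ∀ᶠ q in 𝓝 p, V q = ∑ j, f j q • s j (i q) := by
  set e := trivializationAt E' (TangentSpace 𝓘(ℝ, E') : N → Type _) (i p)
  let b := Module.finBasis ℝ E'
  have hp : e.baseSet ∈ 𝓝 (i p) := e.open_baseSet.mem_nhds (mem_baseSet_trivializationAt E' _ _)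
  obtain ⟨χ, hχ, hχ1, hχU⟩ := exists_contMDiff_eventually_eq_one (E := E') hp
  refine ⟨fun j x ↦ χ x • e.localFrame b j x, fun j ↦ ?_, fun V hV ↦
    ⟨fun j q ↦ χ (i q) * e.localFrameCoeff 𝓘(ℝ, E') b j (i q) (V q), fun j ↦ ?_, ?_⟩⟩
  · exact smoothAlong_smul_of_tsupport (i := id) contMDiff_id hχ fun q hq ↦
      contMDiffAt_localFrame_of_mem ∞ e b j (hχU hq)
  · refine contMDiff_mul_of_tsupport (hχ.comp hi) fun q hq ↦ ?_
    exact (hV q).localFrameCoeff e (hχU (tsupport_comp_subset_preimage χ hi.continuous hq)) b j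
  · filter_upwards [hi.continuous.continuousAt.eventually hχ1, hi.continuous.continuousAt hp]
      with q hq hqe
    classical
    simpa [hq] using e.eq_sum_localFrameCoeff_smul (I := 𝓘(ℝ, E')) (b := b) hqe
      (s := Function.update 0 (i q) (V q))

lemma SmoothAlong.induction [FiniteDimensional ℝ E'] [T2Space N]
    (hi : ContMDiff 𝓘(ℝ, E) 𝓘(ℝ, E') ∞ i) (p : M)
    {P : (Π p : M, TangentSpace 𝓘(ℝ, E') (i p)) → Prop}
    (congr : ∀ V W, SmoothAlong E i V → SmoothAlong E i W →
      (∀ᶠ q in 𝓝 p, W q = V q) → P V → P W)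
    (add : ∀ V W, SmoothAlong E i V → SmoothAlong E i W → P V → P W → P (fun q ↦ V q + W q))
    (smul : ∀ (f : M → ℝ) V, ContMDiff 𝓘(ℝ, E) 𝓘(ℝ) ∞ f → SmoothAlong E i V → P V →
      P (fun q ↦ f q • V q))
    (comp : ∀ s : Π x : N, TangentSpace 𝓘(ℝ, E') x, IsSmoothVF s → P (fun q ↦ s (i q)))
    (hV : SmoothAlong E i V) : P V := by
  obtain ⟨s, hs, hframe⟩ := exists_isSmoothVF_frame hi p
  obtain ⟨f, hf, hfV⟩ := hframe V hV
  have hterm (j) : SmoothAlong E i (fun q ↦ f j q • s j (i q)) := fun q ↦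
    ((hs j).smoothAlong_comp hi q).smul (hf j q)
  have hsum (t : Finset _) : SmoothAlong E i (fun q ↦ ∑ j ∈ t, f j q • s j (i q)) :=
    fun q ↦ SmoothAlongAt.sum (hi q) fun j _ ↦ hterm j q
  refine congr _ _ (hsum Finset.univ) hV hfV ?_
  generalize (Finset.univ : Finset (Fin (Module.finrank ℝ E'))) = t
  classical
  induction t using Finset.induction_on with
  | empty => exact comp 0 (fun q ↦ smoothAlongAt_zero (i := id) contMDiffAt_id)
  | insert a t ha ih =>
    simp only [Finset.sum_insert ha]
    exact add _ _ (hterm a) (hsum t)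
      (smul _ _ (hf a) ((hs a).smoothAlong_comp hi) (comp _ (hs a))) ih

end Along

section VectorFields

variable {E : Type*} [NormedAddCommGroup E] [NormedSpace ℝ E]
  {M : Type*} [TopologicalSpace M] [ChartedSpace E M] [IsManifold 𝓘(ℝ, E) ∞ M]
  {X Y Z : Π p : M, TangentSpace 𝓘(ℝ, E) p} {f : M → ℝ}

lemma IsSmoothVF.mdifferentiableAt (hX : IsSmoothVF X) (p : M) :
    MDifferentiableAt 𝓘(ℝ, E) 𝓘(ℝ, E).tangent
      (fun q ↦ (⟨q, X q⟩ : TangentBundle 𝓘(ℝ, E) M)) p :=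
  (hX p).mdifferentiableAt (by simp)

lemma IsSmoothVF.add (hX : IsSmoothVF X) (hY : IsSmoothVF Y) : IsSmoothVF (X + Y) :=
  ContMDiff.add_section hX hY

lemma IsSmoothVF.smul (hf : ContMDiff 𝓘(ℝ, E) 𝓘(ℝ) ∞ f) (hX : IsSmoothVF X) :
    IsSmoothVF (f • X) :=
  ContMDiff.smul_section hf hX

lemma IsSmoothVF.mlieBracket [CompleteSpace E] (hX : IsSmoothVF X) (hY : IsSmoothVF Y) :
    IsSmoothVF (VectorField.mlieBracket 𝓘(ℝ, E) X Y) :=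
  have : IsManifold 𝓘(ℝ, E) (minSmoothness ℝ 2) M := by
    rw [minSmoothness_of_isRCLikeNormedField]
    exact IsManifold.of_le (n := ∞) ENat.LEInfty.out
  have : IsManifold 𝓘(ℝ, E) (((⊤ : ℕ∞) : WithTop ℕ∞) + 1) M := ‹IsManifold 𝓘(ℝ, E) ∞ M›
  ContDiff.mlieBracket_vectorField (m := ⊤) (n := ⊤) hX hY (by simp)

lemma contMDiff_mvfderiv_apply (hf : ContMDiff 𝓘(ℝ, E) 𝓘(ℝ) ∞ f) (hX : IsSmoothVF X) :
    ContMDiff 𝓘(ℝ, E) 𝓘(ℝ) ∞ (fun p ↦ mvfderiv 𝓘(ℝ, E) f p (X p)) :=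
  (contMDiff_snd_tangentBundle_modelSpace ℝ 𝓘(ℝ)).comp
    ((hf.contMDiff_tangentMap (by simp)).comp hX)

lemma IsSmoothVF.smoothAlong_diff
    {E' : Type*} [NormedAddCommGroup E'] [NormedSpace ℝ E']
    {N : Type*} [TopologicalSpace N] [ChartedSpace E' N] [IsManifold 𝓘(ℝ, E') ∞ N]
    {i : M → N} (hX : IsSmoothVF X) (hi : ContMDiff 𝓘(ℝ, E) 𝓘(ℝ, E') ∞ i) :
    SmoothAlong E i (fun p ↦ diff (E := E) (E' := E') i p (X p)) :=
  (hi.contMDiff_tangentMap (by simp)).comp hX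

lemma exists_isSmoothVF_apply_eq [FiniteDimensional ℝ E] [T2Space M] {p : M}
    (v : TangentSpace 𝓘(ℝ, E) p) :
    ∃ X : Π p : M, TangentSpace 𝓘(ℝ, E) p, IsSmoothVF X ∧ X p = v := by
  obtain ⟨U, hU, hext⟩ := FiberBundle.exists_contMDiffOn_extend 𝓘(ℝ, E) E (k := ∞) v
  obtain ⟨χ, hχ, hχ1, hχU⟩ := exists_contMDiff_eventually_eq_one (E := E) (interior_mem_nhds.2 hU)
  refine ⟨χ • FiberBundle.extend E v,
    ContMDiffOn.smul_section_of_tsupport hχ.contMDiffOn isOpen_interior hχU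
      (hext.mono interior_subset), ?_⟩
  rw [Pi.smul_apply', hχ1.self_of_nhds, one_smul, FiberBundle.extend_apply_self]

end VectorFields

section Derivations

variable {E : Type*} [NormedAddCommGroup E] [NormedSpace ℝ E]
  {M : Type*} [TopologicalSpace M] [ChartedSpace E M] {p : M} {f f' : M → ℝ}

lemma mvfderiv_congr (h : f =ᶠ[𝓝 p] f') : mvfderiv 𝓘(ℝ, E) f p = mvfderiv 𝓘(ℝ, E) f' p := by
  ext v
  rw [mvfderiv, mvfderiv, h.mfderiv_eq]
  rfl

lemma mvfderiv_sum_mul {ι : Type*} (t : Finset ι) {f g : ι → M → ℝ}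
    (hf : ∀ j ∈ t, MDifferentiableAt 𝓘(ℝ, E) 𝓘(ℝ) (f j) p)
    (hg : ∀ j ∈ t, MDifferentiableAt 𝓘(ℝ, E) 𝓘(ℝ) (g j) p) (u : TangentSpace 𝓘(ℝ, E) p) :
    mvfderiv 𝓘(ℝ, E) (fun q ↦ ∑ j ∈ t, f j q * g j q) p u
      = ∑ j ∈ t, (mvfderiv 𝓘(ℝ, E) (f j) p u * g j p + f j p * mvfderiv 𝓘(ℝ, E) (g j) p u) := by
  classical
  suffices MDifferentiableAt 𝓘(ℝ, E) 𝓘(ℝ) (fun q ↦ ∑ j ∈ t, f j q * g j q) p ∧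
      mvfderiv 𝓘(ℝ, E) (fun q ↦ ∑ j ∈ t, f j q * g j q) p u = ∑ j ∈ t,
        (mvfderiv 𝓘(ℝ, E) (f j) p u * g j p + f j p * mvfderiv 𝓘(ℝ, E) (g j) p u) from this.2
  induction t using Finset.induction_on with
  | empty => simp [mvfderiv_const, mdifferentiableAt_const]
  | insert a t ha ih =>
    simp only [Finset.forall_mem_insert] at hf hg
    obtain ⟨hsum, hsum'⟩ := ih hf.2 hg.2
    have hmul : MDifferentiableAt 𝓘(ℝ, E) 𝓘(ℝ) (fun q ↦ f a q * g a q) p := hf.1.mul hg.1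
    simp only [Finset.sum_insert ha]
    refine ⟨hmul.add hsum, ?_⟩
    rw [mvfderiv_fun_add hmul hsum, mvfderiv_fun_mul hf.1 hg.1, add_apply, hsum']
    simp only [add_apply, smul_apply, smul_eq_mul]
    ring

variable [IsManifold 𝓘(ℝ, E) ∞ M] {X Y Z : Π p : M, TangentSpace 𝓘(ℝ, E) p}

lemma mlieBracket_mlieBracket_smul [CompleteSpace E] (hY : IsSmoothVF Y)
    (hZ : IsSmoothVF Z) (hf : ContMDiff 𝓘(ℝ, E) 𝓘(ℝ) ∞ f) (p : M) :
    VectorField.mlieBracket 𝓘(ℝ, E) X (VectorField.mlieBracket 𝓘(ℝ, E) Y (f • Z)) p =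
      mvfderiv 𝓘(ℝ, E) (fun q ↦ mvfderiv 𝓘(ℝ, E) f q (Y q)) p (X p) • Z p
      + mvfderiv 𝓘(ℝ, E) f p (Y p) • VectorField.mlieBracket 𝓘(ℝ, E) X Z p
      + (mvfderiv 𝓘(ℝ, E) f p (X p) • VectorField.mlieBracket 𝓘(ℝ, E) Y Z p
      + f p • VectorField.mlieBracket 𝓘(ℝ, E) X (VectorField.mlieBracket 𝓘(ℝ, E) Y Z) p) := by
  have hf' := hf.mdifferentiable (by simp)
  have hYf := contMDiff_mvfderiv_apply hf hY
  have hYZ := hY.mlieBracket hZ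
  have inner : VectorField.mlieBracket 𝓘(ℝ, E) Y (f • Z)
      = (fun q ↦ mvfderiv 𝓘(ℝ, E) f q (Y q)) • Z + f • VectorField.mlieBracket 𝓘(ℝ, E) Y Z := by
    funext q
    exact VectorField.mlieBracket_smul_right (hf' q) (hZ.mdifferentiableAt q)
  rw [inner, VectorField.mlieBracket_add_right ((hZ.smul hYf).mdifferentiableAt p)
      ((hYZ.smul hf).mdifferentiableAt p),
    VectorField.mlieBracket_smul_right (hYf.mdifferentiable (by simp) p) (hZ.mdifferentiableAt p),
    VectorField.mlieBracket_smul_right (hf' p) (hYZ.mdifferentiableAt p)]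

lemma mlieBracket_mlieBracket_apply [CompleteSpace E] (hX : IsSmoothVF X) (hY : IsSmoothVF Y)
    (hZ : IsSmoothVF Z) (p : M) :
    VectorField.mlieBracket 𝓘(ℝ, E) X (VectorField.mlieBracket 𝓘(ℝ, E) Y Z) p =
      VectorField.mlieBracket 𝓘(ℝ, E) (VectorField.mlieBracket 𝓘(ℝ, E) X Y) Z p
        + VectorField.mlieBracket 𝓘(ℝ, E) Y (VectorField.mlieBracket 𝓘(ℝ, E) X Z) p := by
  have : IsManifold 𝓘(ℝ, E) (minSmoothness ℝ 3) M := by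
    rw [minSmoothness_of_isRCLikeNormedField]
    exact IsManifold.of_le (n := ∞) ENat.LEInfty.out
  have le_infty : minSmoothness ℝ 2 ≤ ∞ := by
    rw [minSmoothness_of_isRCLikeNormedField]
    exact ENat.LEInfty.out
  exact VectorField.leibniz_identity_mlieBracket_apply ((hX p).of_le le_infty)
    ((hY p).of_le le_infty) ((hZ p).of_le le_infty)

lemma mvfderiv_mlieBracket [FiniteDimensional ℝ E] [T2Space M] (hX : IsSmoothVF X)
    (hY : IsSmoothVF Y) (hf : ContMDiff 𝓘(ℝ, E) 𝓘(ℝ) ∞ f) (p : M) :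
    mvfderiv 𝓘(ℝ, E) f p (VectorField.mlieBracket 𝓘(ℝ, E) X Y p)
      = mvfderiv 𝓘(ℝ, E) (fun q ↦ mvfderiv 𝓘(ℝ, E) f q (Y q)) p (X p)
        - mvfderiv 𝓘(ℝ, E) (fun q ↦ mvfderiv 𝓘(ℝ, E) f q (X q)) p (Y p) := by
  have := FiniteDimensional.complete ℝ E
  rcases subsingleton_or_nontrivial (TangentSpace 𝓘(ℝ, E) p) with hE | hE
  · rw [Subsingleton.elim (VectorField.mlieBracket 𝓘(ℝ, E) X Y p) 0,
      Subsingleton.elim (X p) 0, Subsingleton.elim (Y p) 0, map_zero, map_zero, map_zero, sub_zero]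
  -- Compare the Jacobi identities for `X, Y, Z` and for `X, Y, fZ`, where `Z p ≠ 0`.
  obtain ⟨v, hv⟩ := exists_ne (0 : TangentSpace 𝓘(ℝ, E) p)
  obtain ⟨Z, hZ, rfl⟩ := exists_isSmoothVF_apply_eq v
  have jacobi := mlieBracket_mlieBracket_apply hX hY (hZ.smul hf) p
  rw [mlieBracket_mlieBracket_smul hY hZ hf, mlieBracket_mlieBracket_smul hX hZ hf,
    VectorField.mlieBracket_smul_right (hf.mdifferentiable (by simp) p) (hZ.mdifferentiableAt p),
    mlieBracket_mlieBracket_apply hX hY hZ, ← sub_eq_zero] at jacobi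
  refine sub_eq_zero.1 ((smul_eq_zero.1 ?_).resolve_right hv)
  rw [← neg_eq_zero, ← jacobi]
  module

lemma eq_zero_of_mvfderiv_eq_zero [FiniteDimensional ℝ E] [T2Space M]
    {v : TangentSpace 𝓘(ℝ, E) p}
    (h : ∀ f : M → ℝ, ContMDiff 𝓘(ℝ, E) 𝓘(ℝ) ∞ f → mvfderiv 𝓘(ℝ, E) f p v = 0) : v = 0 := by
  obtain ⟨χ, hχ, hχ1, hχU⟩ := exists_contMDiff_eventually_eq_one (E := E)
    (chart_source_mem_nhds E p)
  have hchart : MDifferentiableAt 𝓘(ℝ, E) 𝓘(ℝ, E) (extChartAt 𝓘(ℝ, E) p) p :=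
    (contMDiffAt_extChartAt (n := ∞)).mdifferentiableAt (by simp)
  suffices hv : mfderiv 𝓘(ℝ, E) 𝓘(ℝ, E) (extChartAt 𝓘(ℝ, E) p) p v = 0 from
    (isInvertible_mfderiv_extChartAt (mem_extChartAt_source (I := 𝓘(ℝ, E)) p)).injective
      (hv.trans (map_zero _).symm)
  refine SeparatingDual.eq_zero_of_forall_dual_eq_zero (R := ℝ) (V := E) fun l ↦ ?_
  have hcoord : ∀ q ∈ tsupport χ,
      ContMDiffAt 𝓘(ℝ, E) 𝓘(ℝ) ∞ (fun q ↦ l (extChartAt 𝓘(ℝ, E) p q)) q := fun q hq ↦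
    l.contMDiff.contMDiffAt.comp q (contMDiffAt_extChartAt' (hχU hq))
  have hlocal : (fun q ↦ χ q * l (extChartAt 𝓘(ℝ, E) p q)) =ᶠ[𝓝 p] l ∘ extChartAt 𝓘(ℝ, E) p :=
    hχ1.mono fun q hq ↦ by simp [hq]
  have hzero := h _ (contMDiff_mul_of_tsupport hχ hcoord)
  rw [mvfderiv_congr hlocal, mvfderiv_comp_apply p l.mdifferentiableAt hchart] at hzero
  rwa [mvfderiv, l.mfderiv_eq] at hzero

end Derivations

/-! ### The pullback connection -/

section CovariantDerivative

variable {𝕜 : Type*} [NontriviallyNormedField 𝕜]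
  {E : Type*} [NormedAddCommGroup E] [NormedSpace 𝕜 E]
  {H : Type*} [TopologicalSpace H] {I : ModelWithCorners 𝕜 E H}
  {M : Type*} [TopologicalSpace M] [ChartedSpace H M]
  {F : Type*} [NormedAddCommGroup F] [NormedSpace 𝕜 F]
  {V : M → Type*} [TopologicalSpace (TotalSpace F V)]
  [∀ x, AddCommGroup (V x)] [∀ x, Module 𝕜 (V x)] [∀ x, TopologicalSpace (V x)]
  [∀ x, IsTopologicalAddGroup (V x)] [∀ x, ContinuousSMul 𝕜 (V x)]
  [FiberBundle F V] [VectorBundle 𝕜 F V] {D : CovariantDerivative I F V}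

lemma covariantDerivative_sum_smul {x : M} {ι : Type*} (t : Finset ι) {f : ι → M → 𝕜}
    {s : ι → Π x : M, V x}
    (hf : ∀ j ∈ t, MDifferentiableAt I 𝓘(𝕜, 𝕜) (f j) x)
    (hs : ∀ j ∈ t, MDifferentiableAt I (I.prod 𝓘(𝕜, F))
      (fun y ↦ (⟨y, s j y⟩ : TotalSpace F V)) x) :
    D (fun y ↦ ∑ j ∈ t, f j y • s j y) x
      = ∑ j ∈ t, (f j x • D (s j) x + (mvfderiv I (f j) x).smulRight (s j x)) := by
  have hD := D.isCovariantDerivativeOnUniv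
  classical
  induction t using Finset.induction_on with
  | empty =>
    simp only [Finset.sum_empty]
    exact congrFun D.zero x
  | insert a t ha ih =>
    simp only [Finset.forall_mem_insert] at hf hs
    simp only [Finset.sum_insert ha]
    rw [← ih hf.2 hs.2, ← hD.leibniz hs.1 hf.1]
    exact hD.add (hf.1.smul_section hs.1)
      (MDifferentiableAt.sum_section fun j hj ↦ (hf.2 j hj).smul_section (hs.2 j hj))

end CovariantDerivative

section Differential

variable {E : Type*} [NormedAddCommGroup E] [NormedSpace ℝ E]
  {M : Type*} [TopologicalSpace M] [ChartedSpace E M]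
  {E' : Type*} [NormedAddCommGroup E'] [NormedSpace ℝ E']
  {N : Type*} [TopologicalSpace N] [ChartedSpace E' N] {i : M → N} {p : M}

lemma mvfderiv_comp_diff {f : N → ℝ} (hf : MDifferentiableAt 𝓘(ℝ, E') 𝓘(ℝ) f (i p))
    (hi : MDifferentiableAt 𝓘(ℝ, E) 𝓘(ℝ, E') i p) (u : TangentSpace 𝓘(ℝ, E) p) :
    mvfderiv 𝓘(ℝ, E) (fun q ↦ f (i q)) p u = mvfderiv 𝓘(ℝ, E') f (i p) (diff i p u) :=
  mvfderiv_comp_apply p hf hi u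

end Differential

section CovAlong

variable {E : Type*} [NormedAddCommGroup E] [NormedSpace ℝ E]
  {M : Type*} [TopologicalSpace M] [ChartedSpace E M]
  {E' : Type*} [NormedAddCommGroup E'] [NormedSpace ℝ E'] [FiniteDimensional ℝ E']
  {N : Type*} [TopologicalSpace N] [ChartedSpace E' N] [IsManifold 𝓘(ℝ, E') ∞ N]
  {D : CovariantDerivative 𝓘(ℝ, E') E' (TangentSpace 𝓘(ℝ, E') : N → Type _)}
  {i : M → N} {V W : Π p : M, TangentSpace 𝓘(ℝ, E') (i p)} {p : M}

lemma covAlong_congr (h : ∀ᶠ q in 𝓝 p, W q = V q) (u : TangentSpace 𝓘(ℝ, E) p) :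
    covAlong D i W p u = covAlong D i V p u := by
  refine Finset.sum_congr rfl fun j _ ↦ ?_
  rw [h.self_of_nhds]
  congr 3
  exact mvfderiv_congr (h.mono fun q hq ↦ by simp only [hq])

lemma SmoothAlongAt.mdifferentiableAt_localFrameCoeff (hV : SmoothAlongAt E i V p)
    (j : Fin (Module.finrank ℝ E')) :
    MDifferentiableAt 𝓘(ℝ, E) 𝓘(ℝ) (fun q ↦ (trivializationAt E'
      (TangentSpace 𝓘(ℝ, E') : N → Type _) (i p)).localFrameCoeff 𝓘(ℝ, E')
      (Module.finBasis ℝ E') j (i q) (V q)) p :=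
  (hV.localFrameCoeff _ (mem_baseSet_trivializationAt E' _ (i p)) _ j).mdifferentiableAt (by simp)

lemma covAlong_add (hV : SmoothAlongAt E i V p) (hW : SmoothAlongAt E i W p)
    (u : TangentSpace 𝓘(ℝ, E) p) :
    covAlong D i (fun q ↦ V q + W q) p u = covAlong D i V p u + covAlong D i W p u := by
  simp only [covAlong, map_add, ← Finset.sum_add_distrib]
  refine Finset.sum_congr rfl fun j _ ↦ ?_
  rw [mvfderiv_fun_add (hV.mdifferentiableAt_localFrameCoeff j)
    (hW.mdifferentiableAt_localFrameCoeff j), add_apply]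
  module

lemma covAlong_smul {f : M → ℝ} (hf : MDifferentiableAt 𝓘(ℝ, E) 𝓘(ℝ) f p)
    (hV : SmoothAlongAt E i V p) (u : TangentSpace 𝓘(ℝ, E) p) :
    covAlong D i (fun q ↦ f q • V q) p u
      = mvfderiv 𝓘(ℝ, E) f p u • V p + f p • covAlong D i V p u := by
  classical
  have expand := (trivializationAt E' (TangentSpace 𝓘(ℝ, E') : N → Type _)
    (i p)).eq_sum_localFrameCoeff_smul (I := 𝓘(ℝ, E')) (b := Module.finBasis ℝ E')
    (mem_baseSet_trivializationAt E' _ (i p)) (s := Function.update 0 (i p) (V p))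
  rw [Function.update_self] at expand
  conv_rhs => enter [1, 2]; rw [expand]
  simp only [covAlong, map_smul, smul_eq_mul, Finset.smul_sum, ← Finset.sum_add_distrib]
  refine Finset.sum_congr rfl fun j _ ↦ ?_
  rw [mvfderiv_fun_mul hf (hV.mdifferentiableAt_localFrameCoeff j)]
  simp only [add_apply, smul_apply, smul_eq_mul]
  module

lemma covAlong_comp (hi : MDifferentiableAt 𝓘(ℝ, E) 𝓘(ℝ, E') i p)
    {s : Π x : N, TangentSpace 𝓘(ℝ, E') x} (hs : IsSmoothVF s) (u : TangentSpace 𝓘(ℝ, E) p) :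
    covAlong D i (fun q ↦ s (i q)) p u = D s (i p) (diff i p u) := by
  set e := trivializationAt E' (TangentSpace 𝓘(ℝ, E') : N → Type _) (i p)
  set b := Module.finBasis ℝ E'
  have hp : i p ∈ e.baseSet := mem_baseSet_trivializationAt E' _ (i p)
  have hcoeff (j) : MDifferentiableAt 𝓘(ℝ, E') 𝓘(ℝ)
      (fun x ↦ e.localFrameCoeff 𝓘(ℝ, E') b j x (s x)) (i p) :=
    (SmoothAlongAt.localFrameCoeff (i := id) (hs (i p)) e hp b j).mdifferentiableAt (by simp)
  have hframe (j) : MDifferentiableAt 𝓘(ℝ, E') 𝓘(ℝ, E').tangent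
      (fun y ↦ (⟨y, e.localFrame b j y⟩ : TangentBundle 𝓘(ℝ, E') N)) (i p) :=
    (contMDiffAt_localFrame_of_mem ∞ e b j hp).mdifferentiableAt (by simp)
  have expand : D s (i p) = D (fun x ↦ ∑ j, e.localFrameCoeff 𝓘(ℝ, E') b j x (s x)
      • e.localFrame b j x) (i p) :=
    D.isCovariantDerivativeOnUniv.congr_of_eventuallyEq (hs.mdifferentiableAt _)
      (MDifferentiableAt.sum_section fun j _ ↦ (hcoeff j).smul_section (hframe j))
      univ_mem (e.eventually_eq_localFrame_sum_coeff_smul b hp)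
  rw [expand, covariantDerivative_sum_smul _ (fun j _ ↦ hcoeff j) (fun j _ ↦ hframe j), sum_apply]
  refine Finset.sum_congr rfl fun j _ ↦ ?_
  rw [mvfderiv_comp_diff (hcoeff j) hi, add_apply, smul_apply,
    ContinuousLinearMap.smulRight_apply, add_comm]

lemma covAlong_zero (hi : MDifferentiableAt 𝓘(ℝ, E) 𝓘(ℝ, E') i p) (u : TangentSpace 𝓘(ℝ, E) p) :
    covAlong D i (fun q ↦ (0 : TangentSpace 𝓘(ℝ, E') (i q))) p u = 0 := by
  refine (covAlong_comp (D := D) hi (s := 0)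
    (fun _ ↦ smoothAlongAt_zero (i := id) contMDiffAt_id) u).trans ?_
  rw [CovariantDerivative.zero]
  rfl

lemma covAlong_sum_smul {ι : Type*} (t : Finset ι) {f : ι → M → ℝ}
    {V : ι → Π p : M, TangentSpace 𝓘(ℝ, E') (i p)} (hi : ContMDiffAt 𝓘(ℝ, E) 𝓘(ℝ, E') ∞ i p)
    (hf : ∀ j, ContMDiffAt 𝓘(ℝ, E) 𝓘(ℝ) ∞ (f j) p) (hV : ∀ j, SmoothAlongAt E i (V j) p)
    (u : TangentSpace 𝓘(ℝ, E) p) :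
    covAlong D i (fun q ↦ ∑ j ∈ t, f j q • V j q) p u
      = ∑ j ∈ t, (mvfderiv 𝓘(ℝ, E) (f j) p u • V j p + f j p • covAlong D i (V j) p u) := by
  classical
  induction t using Finset.induction_on with
  | empty => simpa only [Finset.sum_empty] using covAlong_zero (hi.mdifferentiableAt (by simp)) u
  | insert a t ha ih =>
    simp only [Finset.sum_insert ha]
    rw [covAlong_add ((hV a).smul (hf a)) (SmoothAlongAt.sum hi fun j _ ↦ (hV j).smul (hf j)),
      covAlong_smul ((hf a).mdifferentiableAt (by simp)) (hV a), ih]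

variable [T2Space N]

lemma SmoothAlong.covAlong [IsManifold 𝓘(ℝ, E) ∞ M]
    (hD : ContMDiffCovariantDerivativeOn E' ∞ D.toFun Set.univ)
    (hi : ContMDiff 𝓘(ℝ, E) 𝓘(ℝ, E') ∞ i) (hV : SmoothAlong E i V)
    {X : Π p : M, TangentSpace 𝓘(ℝ, E) p} (hX : IsSmoothVF X) :
    SmoothAlong E i (fun p ↦ covAlong D i V p (X p)) := by
  intro p
  refine SmoothAlong.induction hi p (V := V)
    (P := fun V ↦ SmoothAlongAt E i (fun p ↦ Lightlike.covAlong D i V p (X p)) p)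
    (fun V W _ _ h hV ↦ hV.congr ?congr)
    (fun V W hV hW ihV ihW ↦ (ihV.add ihW).congr ?add)
    (fun f V hf hV ih ↦
      (((hV p).smul (contMDiff_mvfderiv_apply hf hX p)).add (ih.smul (hf p))).congr ?smul)
    (fun s hs ↦ ?comp) hV
  case congr =>
    filter_upwards [eventually_eventually_nhds.2 h] with q hq using covAlong_congr hq _
  case add => exact Eventually.of_forall fun q ↦ covAlong_add (hV q) (hW q) _
  case smul =>
    exact Eventually.of_forall fun q ↦
      covAlong_smul (hf.mdifferentiable (by simp) q) (hV q) _
  case comp =>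
    simp only [covAlong_comp (hi.mdifferentiable (by simp) _) hs]
    have hDs := (hD.contMDiff (σ := s) (ContMDiff.contMDiffOn hs)).contMDiffAt
      (x := i p) univ_mem
    exact ContMDiffAt.clm_bundle_apply (hDs.comp p (hi p)) (hX.smoothAlong_diff hi p)

end CovAlong

section Metric

variable {E : Type*} [NormedAddCommGroup E] [NormedSpace ℝ E]
  {M : Type*} [TopologicalSpace M] [ChartedSpace E M]
  {E' : Type*} [NormedAddCommGroup E'] [NormedSpace ℝ E']
  {N : Type*} [TopologicalSpace N] [ChartedSpace E' N] [IsManifold 𝓘(ℝ, E') ∞ N]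
  {g : SemiRiemannianMetric E' N}
  {D : CovariantDerivative 𝓘(ℝ, E') E' (TangentSpace 𝓘(ℝ, E') : N → Type _)}
  {i : M → N} {V W : Π p : M, TangentSpace 𝓘(ℝ, E') (i p)} {p : M}

lemma SemiRiemannianMetric.contMDiffAt_apply (g : SemiRiemannianMetric E' N)
    (hV : SmoothAlongAt E i V p) (hW : SmoothAlongAt E i W p) :
    ContMDiffAt 𝓘(ℝ, E) 𝓘(ℝ) ∞ (fun q ↦ g.val (i q) (V q) (W q)) p := by
  have h : ContMDiffAt 𝓘(ℝ, E) (𝓘(ℝ, E').prod 𝓘(ℝ)) ∞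
      (fun m ↦ TotalSpace.mk' ℝ (E := Bundle.Trivial N ℝ) (i m) (g.val (i m) (V m) (W m))) p :=
    ContMDiffAt.clm_bundle_apply₂ (F₁ := E') (F₂ := E')
      (ContMDiffAt.comp p (g.contMDiff (i p)) hV.contMDiffAt_base) hV hW
  exact (contMDiffAt_totalSpace.1 h).2

variable [FiniteDimensional ℝ E'] [T2Space N]

lemma mvfderiv_metric_of_comp (hi : ContMDiff 𝓘(ℝ, E) 𝓘(ℝ, E') ∞ i) {u : TangentSpace 𝓘(ℝ, E) p}
    (hV : SmoothAlong E i V) (hW : SmoothAlong E i W)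
    (hcomp : ∀ s : Π x : N, TangentSpace 𝓘(ℝ, E') x, IsSmoothVF s →
      mvfderiv 𝓘(ℝ, E) (fun q ↦ g.val (i q) (s (i q)) (W q)) p u
        = g.val (i p) (covAlong D i (fun q ↦ s (i q)) p u) (W p)
          + g.val (i p) (s (i p)) (covAlong D i W p u)) :
    mvfderiv 𝓘(ℝ, E) (fun q ↦ g.val (i q) (V q) (W q)) p u
      = g.val (i p) (covAlong D i V p u) (W p) + g.val (i p) (V p) (covAlong D i W p u) := by
  have mdiff {V : Π p : M, TangentSpace 𝓘(ℝ, E') (i p)} (hV : SmoothAlong E i V) :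
      MDifferentiableAt 𝓘(ℝ, E) 𝓘(ℝ) (fun q ↦ g.val (i q) (V q) (W q)) p :=
    (g.contMDiffAt_apply (hV p) (hW p)).mdifferentiableAt (by simp)
  refine SmoothAlong.induction hi p (V := V) (P := fun V ↦
    mvfderiv 𝓘(ℝ, E) (fun q ↦ g.val (i q) (V q) (W q)) p u
      = g.val (i p) (covAlong D i V p u) (W p) + g.val (i p) (V p) (covAlong D i W p u))
    (fun V V' _ _ h hV ↦ ?congr) (fun V V' hV hV' ih ih' ↦ ?add) (fun f V hf hV ih ↦ ?smul)
    hcomp hV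
  case congr =>
    have hVW : (fun q ↦ g.val (i q) (V' q) (W q)) =ᶠ[𝓝 p] (fun q ↦ g.val (i q) (V q) (W q)) :=
      h.mono fun q hq ↦ by simp only [hq]
    rw [covAlong_congr h, h.self_of_nhds, ← hV, mvfderiv_congr hVW]
  case add =>
    simp only [map_add, add_apply]
    rw [mvfderiv_fun_add (mdiff hV) (mdiff hV'), covAlong_add (hV p) (hV' p), add_apply, ih, ih']
    simp only [map_add, add_apply]
    ring
  case smul =>
    have hf' := hf.mdifferentiable (by simp) p
    simp only [map_smul, smul_apply, smul_eq_mul]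
    rw [mvfderiv_fun_mul hf' (mdiff hV), covAlong_smul hf' (hV p)]
    simp only [map_add, add_apply, map_smul, smul_apply, smul_eq_mul, ih]
    ring

lemma SemiRiemannianMetric.IsLeviCivita.metric_along (hD : g.IsLeviCivita D)
    (hi : ContMDiff 𝓘(ℝ, E) 𝓘(ℝ, E') ∞ i) (hV : SmoothAlong E i V) (hW : SmoothAlong E i W)
    (u : TangentSpace 𝓘(ℝ, E) p) :
    mvfderiv 𝓘(ℝ, E) (fun q ↦ g.val (i q) (V q) (W q)) p u
      = g.val (i p) (covAlong D i V p u) (W p) + g.val (i p) (V p) (covAlong D i W p u) := by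
  have hi' := hi.mdifferentiable (by simp) p
  refine mvfderiv_metric_of_comp hi hV hW fun s hs ↦ ?_
  simp only [g.symm _ (s _), g.symm (i p) _ (W p)]
  rw [add_comm]
  refine mvfderiv_metric_of_comp hi hW (hs.smoothAlong_comp hi) fun t ht ↦ ?_
  have hst : MDifferentiableAt 𝓘(ℝ, E') 𝓘(ℝ) (fun y ↦ g.val y (t y) (s y)) (i p) :=
    (g.contMDiffAt_apply (i := id) (ht (i p)) (hs (i p))).mdifferentiableAt (by simp)
  rw [covAlong_comp hi' hs, covAlong_comp hi' ht, mvfderiv_comp_diff hst hi',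
    hD.metric t s (i p) _ (ht.mdifferentiableAt _) (hs.mdifferentiableAt _)]

end Metric

section Pushforward

variable {E : Type*} [NormedAddCommGroup E] [NormedSpace ℝ E]
  {M : Type*} [TopologicalSpace M] [ChartedSpace E M]
  {E' : Type*} [NormedAddCommGroup E'] [NormedSpace ℝ E']
  {N : Type*} [TopologicalSpace N] [ChartedSpace E' N] [IsManifold 𝓘(ℝ, E') ∞ N]
  {i : M → N} {p : M} {X Y : Π p : M, TangentSpace 𝓘(ℝ, E) p} {f : N → ℝ}
  {ι : Type*} [Fintype ι] {s : ι → Π x : N, TangentSpace 𝓘(ℝ, E') x} {x y : ι → M → ℝ}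

lemma mvfderiv_mvfderiv_comp (hi : ContMDiff 𝓘(ℝ, E) 𝓘(ℝ, E') ∞ i)
    (hf : ContMDiff 𝓘(ℝ, E') 𝓘(ℝ) ∞ f) (hs : ∀ j, IsSmoothVF (s j))
    (hy : ∀ j, ContMDiff 𝓘(ℝ, E) 𝓘(ℝ) ∞ (y j))
    (hX : diff i p (X p) = ∑ j, x j p • s j (i p))
    (hY : ∀ᶠ q in 𝓝 p, diff i q (Y q) = ∑ j, y j q • s j (i q)) :
    mvfderiv 𝓘(ℝ, E) (fun q ↦ mvfderiv 𝓘(ℝ, E) (fun q ↦ f (i q)) q (Y q)) p (X p)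
      = ∑ k, mvfderiv 𝓘(ℝ, E) (y k) p (X p) * mvfderiv 𝓘(ℝ, E') f (i p) (s k (i p))
        + ∑ k, ∑ l, x l p * y k p * mvfderiv 𝓘(ℝ, E')
          (fun z ↦ mvfderiv 𝓘(ℝ, E') f z (s k z)) (i p) (s l (i p)) := by
  have hi' := hi.mdifferentiable (by simp)
  have hsf (k) := (contMDiff_mvfderiv_apply hf (hs k)).mdifferentiable (by simp)
  have hsfi (k) : MDifferentiableAt 𝓘(ℝ, E) 𝓘(ℝ)
      (fun q ↦ mvfderiv 𝓘(ℝ, E') f (i q) (s k (i q))) p := (hsf k _).comp p (hi' p)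
  have expand : (fun q ↦ mvfderiv 𝓘(ℝ, E) (fun q ↦ f (i q)) q (Y q)) =ᶠ[𝓝 p]
      (fun q ↦ ∑ k, y k q * mvfderiv 𝓘(ℝ, E') f (i q) (s k (i q))) := by
    filter_upwards [hY] with q hq
    rw [mvfderiv_comp_diff (hf.mdifferentiable (by simp) _) (hi' q), hq, map_sum]
    simp only [map_smul, smul_eq_mul]
  rw [mvfderiv_congr expand, mvfderiv_sum_mul _ (fun k _ ↦ (hy k).mdifferentiable (by simp) p)
    (fun k _ ↦ hsfi k), Finset.sum_add_distrib]
  congr 1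
  refine Finset.sum_congr rfl fun k _ ↦ ?_
  rw [mvfderiv_comp_diff (hsf k _) (hi' p), hX, map_sum, Finset.mul_sum]
  refine Finset.sum_congr rfl fun l _ ↦ ?_
  rw [map_smul, smul_eq_mul]
  ring

lemma diff_mlieBracket [FiniteDimensional ℝ E] [T2Space M] [IsManifold 𝓘(ℝ, E) ∞ M]
    [FiniteDimensional ℝ E'] [T2Space N] (hi : ContMDiff 𝓘(ℝ, E) 𝓘(ℝ, E') ∞ i)
    (hX : IsSmoothVF X) (hY : IsSmoothVF Y) (hs : ∀ j, IsSmoothVF (s j))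
    (hx : ∀ j, ContMDiff 𝓘(ℝ, E) 𝓘(ℝ) ∞ (x j)) (hy : ∀ j, ContMDiff 𝓘(ℝ, E) 𝓘(ℝ) ∞ (y j))
    (hXs : ∀ᶠ q in 𝓝 p, diff i q (X q) = ∑ j, x j q • s j (i q))
    (hYs : ∀ᶠ q in 𝓝 p, diff i q (Y q) = ∑ j, y j q • s j (i q)) :
    diff i p (VectorField.mlieBracket 𝓘(ℝ, E) X Y p)
      = ∑ k, (mvfderiv 𝓘(ℝ, E) (y k) p (X p) - mvfderiv 𝓘(ℝ, E) (x k) p (Y p)) • s k (i p)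
        + ∑ k, ∑ l, (x l p * y k p) • VectorField.mlieBracket 𝓘(ℝ, E') (s l) (s k) (i p) := by
  refine sub_eq_zero.1 (eq_zero_of_mvfderiv_eq_zero fun f hf ↦ ?_)
  have hfi : ContMDiff 𝓘(ℝ, E) 𝓘(ℝ) ∞ (fun q ↦ f (i q)) := hf.comp hi
  rw [map_sub, ← mvfderiv_comp_diff (hf.mdifferentiable (by simp) _)
      (hi.mdifferentiable (by simp) p), mvfderiv_mlieBracket hX hY hfi,
    mvfderiv_mvfderiv_comp hi hf hs hy hXs.self_of_nhds hYs,
    mvfderiv_mvfderiv_comp hi hf hs hx hYs.self_of_nhds hXs]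
  simp only [map_add, map_sum, map_smul, smul_eq_mul, mvfderiv_mlieBracket (hs _) (hs _) hf,
    mul_sub, sub_mul, Finset.sum_sub_distrib]
  rw [Finset.sum_comm (f := fun k l ↦ y l p * x k p * _)]
  simp only [mul_comm (y _ p)]
  ring

end Pushforward

/-! ### Curvature of the Levi-Civita connection -/

section Algebra

variable {V : Type*} [AddCommGroup V] [Module ℝ V]

/-- The algebraic symmetries of a covariant curvature tensor `(x, y, z, w) ↦ g(R(x, y)z, w)`.
Linearity in the last argument implies linearity in all of them. -/
structure IsCurvatureLike (F : V → V → V → V → ℝ) : Prop where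
  add (x y z v w : V) : F x y z (v + w) = F x y z v + F x y z w
  smul (x y z : V) (a : ℝ) (w : V) : F x y z (a • w) = a * F x y z w
  antisymm (x y z w : V) : F x y z w = -F y x z w
  antisymm' (x y z w : V) : F x y z w = -F x y w z
  bianchi (x y z w : V) : F x y z w + F y z x w + F z x y w = 0

namespace IsCurvatureLike

lemma of_symmetric {b : V →ₗ[ℝ] V →ₗ[ℝ] ℝ} (hb : ∀ x y, b x y = b y x) :
    IsCurvatureLike fun x y z w ↦ b y z * b x w - b x z * b y w where
  add x y z v w := by simp only [map_add]; ring
  smul x y z a w := by simp only [map_smul, smul_eq_mul]; ring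
  antisymm x y z w := by ring
  antisymm' x y z w := by ring
  bianchi x y z w := by rw [hb z y, hb x z, hb y x]; ring

variable {F G : V → V → V → V → ℝ}

lemma sub_const_mul (hF : IsCurvatureLike F) (hG : IsCurvatureLike G) (c : ℝ) :
    IsCurvatureLike fun x y z w ↦ F x y z w - c * G x y z w where
  add x y z v w := by rw [hF.add, hG.add]; ring
  smul x y z a w := by rw [hF.smul, hG.smul]; ring
  antisymm x y z w := by rw [hF.antisymm, hG.antisymm]; ring
  antisymm' x y z w := by rw [hF.antisymm', hG.antisymm']; ring
  bianchi x y z w := by linear_combination hF.bianchi x y z w - c * hG.bianchi x y z w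

-- The sum of the four Bianchi identities, with signs, cancels all but the two terms.
lemma pair_symm (hF : IsCurvatureLike F) (x y z w : V) : F x y z w = F z w x y := by
  linarith [hF.bianchi x y z w, hF.bianchi y z w x, hF.bianchi z w x y, hF.bianchi w x y z,
    hF.antisymm' y z x w, hF.antisymm' z x y w, hF.antisymm' z w y x, hF.antisymm' w y z x,
    hF.antisymm' w x z y, hF.antisymm' x z w y, hF.antisymm' x y w z, hF.antisymm' y w x z,
    hF.antisymm z x y w, hF.antisymm w y z x, hF.antisymm x z w y, hF.antisymm y w x z,
    hF.antisymm z x w y, hF.antisymm w y x z]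

lemma add₃ (hF : IsCurvatureLike F) (x y v w z : V) :
    F x y (v + w) z = F x y v z + F x y w z := by
  rw [hF.antisymm', hF.add, hF.antisymm' x y v, hF.antisymm' x y w]; ring

lemma smul₃ (hF : IsCurvatureLike F) (x y : V) (a : ℝ) (w z : V) :
    F x y (a • w) z = a * F x y w z := by
  rw [hF.antisymm', hF.smul, hF.antisymm' x y w]; ring

lemma add₁ (hF : IsCurvatureLike F) (v w x y z : V) :
    F (v + w) x y z = F v x y z + F w x y z := by
  rw [hF.pair_symm, hF.add₃, hF.pair_symm v, hF.pair_symm w]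

lemma smul₁ (hF : IsCurvatureLike F) (a : ℝ) (w x y z : V) :
    F (a • w) x y z = a * F w x y z := by
  rw [hF.pair_symm, hF.smul₃, hF.pair_symm w]

lemma add₂ (hF : IsCurvatureLike F) (x v w y z : V) :
    F x (v + w) y z = F x v y z + F x w y z := by
  rw [hF.pair_symm, hF.add, hF.pair_symm x v, hF.pair_symm x w]

lemma smul₂ (hF : IsCurvatureLike F) (a : ℝ) (x w y z : V) :
    F x (a • w) y z = a * F x w y z := by
  rw [hF.pair_symm, hF.smul, hF.pair_symm x w]

lemma eq_zero_of_diag (hF : IsCurvatureLike F) (h : ∀ x y, F x y y x = 0) (x y z w : V) :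
    F x y z w = 0 := by
  have polarize_outer (x y w : V) : F x y y w = 0 := by
    have h_sum := h (x + w) y
    rw [hF.add, hF.add₁, hF.add₁, h, h] at h_sum
    linarith [hF.pair_symm w y y x, hF.antisymm y x w y, hF.antisymm' x y w y]
  have polarize_inner (x y z w : V) : F x y z w = -F x z y w := by
    have h_sum := polarize_outer x (y + z) w
    rw [hF.add₃, hF.add₂, hF.add₂, polarize_outer, polarize_outer] at h_sum
    linarith
  linarith [hF.bianchi x y z w, hF.antisymm z x y w, polarize_inner x y z w,
    polarize_inner y z x w, hF.antisymm y x z w]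

lemma exists_polynomial_eval_eq (hF : IsCurvatureLike F) (x y u v : V) :
    ∃ P : Polynomial ℝ, ∀ t : ℝ,
      P.eval t = F (x + t • u) (y + t • v) (y + t • v) (x + t • u) := by
  refine ⟨.C (F x y y x) + .C (F u y y x + F x v y x + F x y v x + F x y y u) * .X
    + .C (F u v y x + F u y v x + F u y y u + F x v v x + F x v y u + F x y v u) * .X ^ 2
    + .C (F x v v u + F u y v u + F u v y u + F u v v x) * .X ^ 3 + .C (F u v v u) * .X ^ 4,
    fun t ↦ ?_⟩
  simp only [hF.add, hF.smul, hF.add₁, hF.smul₁, hF.add₂, hF.smul₂, hF.add₃, hF.smul₃,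
    Polynomial.eval_add, Polynomial.eval_mul, Polynomial.eval_C, Polynomial.eval_X,
    Polynomial.eval_pow]
  ring

/-- Along the line from `(x, y)` to `(x₀, y₀)` the two diagonals are polynomials with product
zero. -/
lemma eq_zero_of_diag_or (hF : IsCurvatureLike F) (hG : IsCurvatureLike G)
    (h : ∀ x y, F x y y x = 0 ∨ G x y y x = 0) {x₀ y₀ : V} (h₀ : G x₀ y₀ y₀ x₀ ≠ 0)
    (x y z w : V) : F x y z w = 0 := by
  refine hF.eq_zero_of_diag (fun x y ↦ ?_) x y z w
  obtain ⟨P, hP⟩ := hF.exists_polynomial_eval_eq x y (x₀ - x) (y₀ - y)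
  obtain ⟨Q, hQ⟩ := hG.exists_polynomial_eval_eq x y (x₀ - x) (y₀ - y)
  have hPQ : P * Q = 0 := Polynomial.funext fun t ↦ by
    rw [Polynomial.eval_mul, Polynomial.eval_zero, mul_eq_zero, hP, hQ]
    exact h _ _
  rcases mul_eq_zero.1 hPQ with rfl | rfl
  · simpa using (hP 0).symm
  · exact absurd (by simpa using (hQ 1).symm) h₀

end IsCurvatureLike

end Algebra

section Curvature

variable {E' : Type*} [NormedAddCommGroup E'] [NormedSpace ℝ E']
  {N : Type*} [TopologicalSpace N] [ChartedSpace E' N] [IsManifold 𝓘(ℝ, E') ∞ N]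
  {D : CovariantDerivative 𝓘(ℝ, E') E' (TangentSpace 𝓘(ℝ, E') : N → Type _)}
  {g : SemiRiemannianMetric E' N} {X Y Z W : Π x : N, TangentSpace 𝓘(ℝ, E') x}

/-- The covariant curvature tensor `g(R(X, Y)Z, W)` of `D`. -/
noncomputable def curvatureForm (g : SemiRiemannianMetric E' N)
    (D : CovariantDerivative 𝓘(ℝ, E') E' (TangentSpace 𝓘(ℝ, E') : N → Type _))
    (X Y Z W : Π x : N, TangentSpace 𝓘(ℝ, E') x) (x : N) : ℝ :=
  g.val x (curvature (fun Z y v ↦ D Z y v) X Y Z x) (W x)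

lemma curvature_antisymm (x : N) :
    curvature (fun Z y v ↦ D Z y v) X Y Z x = -curvature (fun Z y v ↦ D Z y v) Y X Z x := by
  simp only [curvature]
  rw [VectorField.mlieBracket_swap_apply, map_neg]
  abel

lemma SemiRiemannianMetric.contMDiff_apply (g : SemiRiemannianMetric E' N) (hX : IsSmoothVF X)
    (hY : IsSmoothVF Y) : ContMDiff 𝓘(ℝ, E') 𝓘(ℝ) ∞ (fun x ↦ g.val x (X x) (Y x)) := fun x ↦
  g.contMDiffAt_apply (i := id) (hX x) (hY x)

variable (E' N) in
/-- The vector space `Γ(TN)` of smooth vector fields. -/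
noncomputable def smoothVectorFields : Submodule ℝ (Π x : N, TangentSpace 𝓘(ℝ, E') x) where
  carrier := {X | IsSmoothVF X}
  add_mem' hX hY := hX.add hY
  zero_mem' _ := smoothAlongAt_zero (i := id) contMDiffAt_id
  smul_mem' a _ hX := hX.smul (f := fun _ ↦ a) contMDiff_const

lemma mlieBracket_cyclic_sum [CompleteSpace E'] (hX : IsSmoothVF X) (hY : IsSmoothVF Y)
    (hZ : IsSmoothVF Z) (x : N) :
    VectorField.mlieBracket 𝓘(ℝ, E') X (VectorField.mlieBracket 𝓘(ℝ, E') Y Z) x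
      + VectorField.mlieBracket 𝓘(ℝ, E') Y (VectorField.mlieBracket 𝓘(ℝ, E') Z X) x
      + VectorField.mlieBracket 𝓘(ℝ, E') Z (VectorField.mlieBracket 𝓘(ℝ, E') X Y) x = 0 := by
  have neg_right : VectorField.mlieBracket 𝓘(ℝ, E') Y (-VectorField.mlieBracket 𝓘(ℝ, E') X Z) x
      = -VectorField.mlieBracket 𝓘(ℝ, E') Y (VectorField.mlieBracket 𝓘(ℝ, E') X Z) x := by
    simpa only [neg_one_smul] using VectorField.mlieBracket_const_smul_right (I := 𝓘(ℝ, E'))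
      (c := (-1 : ℝ)) (V := Y) ((hX.mlieBracket hZ).mdifferentiableAt x)
  rw [mlieBracket_mlieBracket_apply hX hY hZ, VectorField.mlieBracket_swap (V := Z), neg_right,
    VectorField.mlieBracket_swap_apply (V := Z)]
  abel

lemma IsSmoothVF.covariantDerivative
    (hD : ContMDiffCovariantDerivativeOn E' ∞ D.toFun Set.univ)
    (hY : IsSmoothVF Y) (hX : IsSmoothVF X) : IsSmoothVF (fun x ↦ D Y x (X x)) :=
  ContMDiff.clm_bundle_apply (b := id)
    (contMDiffOn_univ.1 (hD.contMDiff (σ := Y) (ContMDiff.contMDiffOn hY))) hX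

namespace SemiRiemannianMetric.IsLeviCivita

lemma covariantDerivative_sub_mlieBracket (hD : g.IsLeviCivita D) (hX : IsSmoothVF X)
    (hY : IsSmoothVF Y) (x : N) :
    D Y x (X x) - VectorField.mlieBracket 𝓘(ℝ, E') X Y x = D X x (Y x) := by
  rw [← hD.torsion_free X Y x (hX.mdifferentiableAt x) (hY.mdifferentiableAt x), sub_sub_cancel]

lemma covariantDerivative_comm_sub [CompleteSpace E'] (hD : g.IsLeviCivita D)
    (hX : IsSmoothVF X) (hY : IsSmoothVF Y) (x : N) (v : TangentSpace 𝓘(ℝ, E') x) :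
    D (fun y ↦ D Y y (X y)) x v - D (fun y ↦ D X y (Y y)) x v
      = D (VectorField.mlieBracket 𝓘(ℝ, E') X Y) x v := by
  have torsion_free : (fun y ↦ D Y y (X y))
      = VectorField.mlieBracket 𝓘(ℝ, E') X Y + fun y ↦ D X y (Y y) :=
    funext fun y ↦ by
      rw [Pi.add_apply, ← hD.covariantDerivative_sub_mlieBracket hX hY y, add_sub_cancel]
  rw [torsion_free, D.isCovariantDerivativeOnUniv.add ((hX.mlieBracket hY).mdifferentiableAt x)
    ((hX.covariantDerivative hD.smooth hY).mdifferentiableAt x), add_apply, add_sub_cancel_right]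

lemma covariantDerivative_comm_sub_sub [CompleteSpace E'] (hD : g.IsLeviCivita D)
    (hX : IsSmoothVF X) (hY : IsSmoothVF Y) (hZ : IsSmoothVF Z) (x : N) :
    D (fun y ↦ D Y y (X y)) x (Z x) - D (fun y ↦ D X y (Y y)) x (Z x)
        - D Z x (VectorField.mlieBracket 𝓘(ℝ, E') X Y x)
      = VectorField.mlieBracket 𝓘(ℝ, E') Z (VectorField.mlieBracket 𝓘(ℝ, E') X Y) x := by
  rw [hD.covariantDerivative_comm_sub hX hY,
    ← hD.covariantDerivative_sub_mlieBracket hZ (hX.mlieBracket hY), sub_sub_cancel]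

lemma bianchi [CompleteSpace E'] (hD : g.IsLeviCivita D) (hX : IsSmoothVF X)
    (hY : IsSmoothVF Y) (hZ : IsSmoothVF Z) (x : N) :
    curvature (fun Z y v ↦ D Z y v) X Y Z x + curvature (fun Z y v ↦ D Z y v) Y Z X x
      + curvature (fun Z y v ↦ D Z y v) Z X Y x = 0 := by
  rw [← mlieBracket_cyclic_sum hX hY hZ x, ← hD.covariantDerivative_comm_sub_sub hX hY hZ,
    ← hD.covariantDerivative_comm_sub_sub hY hZ hX, ← hD.covariantDerivative_comm_sub_sub hZ hX hY]
  simp only [curvature]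
  abel

lemma mvfderiv_metric (hD : g.IsLeviCivita D) (hX : IsSmoothVF X) (hY : IsSmoothVF Y) (x : N)
    (v : TangentSpace 𝓘(ℝ, E') x) :
    mvfderiv 𝓘(ℝ, E') (fun y ↦ g.val y (X y) (Y y)) x v
      = g.val x (D X x v) (Y x) + g.val x (X x) (D Y x v) :=
  hD.metric _ _ x v (hX.mdifferentiableAt x) (hY.mdifferentiableAt x)

lemma mvfderiv_mvfderiv_metric (hD : g.IsLeviCivita D) (hX : IsSmoothVF X) (hZ : IsSmoothVF Z)
    (hW : IsSmoothVF W) (x : N) (v : TangentSpace 𝓘(ℝ, E') x) :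
    mvfderiv 𝓘(ℝ, E')
        (fun y ↦ mvfderiv 𝓘(ℝ, E') (fun y ↦ g.val y (Z y) (W y)) y (X y)) x v
      = g.val x (D (fun y ↦ D Z y (X y)) x v) (W x) + g.val x (D Z x (X x)) (D W x v)
        + (g.val x (D Z x v) (D W x (X x)) + g.val x (Z x) (D (fun y ↦ D W y (X y)) x v)) := by
  have hZX := hZ.covariantDerivative hD.smooth hX
  have hWX := hW.covariantDerivative hD.smooth hX
  rw [funext fun y ↦ hD.mvfderiv_metric hZ hW y (X y),
    mvfderiv_fun_add ((g.contMDiff_apply hZX hW).mdifferentiable (by simp) x)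
      ((g.contMDiff_apply hZ hWX).mdifferentiable (by simp) x), add_apply,
    hD.mvfderiv_metric hZX hW, hD.mvfderiv_metric hZ hWX]

end SemiRiemannianMetric.IsLeviCivita

variable [FiniteDimensional ℝ E'] [T2Space N]

namespace SemiRiemannianMetric.IsLeviCivita

/-- The commutator `[X, Y] - XY + YX` annihilates the function `g(Z, W)`. -/
lemma curvatureForm_antisymm (hD : g.IsLeviCivita D) (hX : IsSmoothVF X) (hY : IsSmoothVF Y)
    (hZ : IsSmoothVF Z) (hW : IsSmoothVF W) (x : N) :
    curvatureForm g D X Y Z W x = -curvatureForm g D X Y W Z x := by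
  have commutator := mvfderiv_mlieBracket hX hY (g.contMDiff_apply hZ hW) x
  rw [hD.mvfderiv_metric hZ hW, hD.mvfderiv_mvfderiv_metric hX hZ hW,
    hD.mvfderiv_mvfderiv_metric hY hZ hW] at commutator
  simp only [curvatureForm, curvature, map_sub, sub_apply]
  rw [g.symm x (D (fun q ↦ D W q (Y q)) x (X x)), g.symm x (D (fun q ↦ D W q (X q)) x (Y x)),
    g.symm x (D W x (VectorField.mlieBracket 𝓘(ℝ, E') X Y x))]
  linarith

lemma isCurvatureLike_curvatureForm (hD : g.IsLeviCivita D) (x : N) :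
    IsCurvatureLike fun X Y Z W : smoothVectorFields E' N ↦ curvatureForm g D X Y Z W x where
  add X Y Z W W' := by
    simp only [curvatureForm, Submodule.coe_add, Pi.add_apply, map_add]
  smul X Y Z a W := by
    simp only [curvatureForm, Submodule.coe_smul, Pi.smul_apply, map_smul, smul_eq_mul]
  antisymm X Y Z W := by
    simp only [curvatureForm, curvature_antisymm (X := X.1), map_neg, neg_apply]
  antisymm' X Y Z W := hD.curvatureForm_antisymm X.2 Y.2 Z.2 W.2 x
  bianchi X Y Z W := by
    have := FiniteDimensional.complete ℝ E'
    simp only [curvatureForm, ← add_apply, ← map_add, hD.bianchi X.2 Y.2 Z.2 x, map_zero,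
      zero_apply]

end SemiRiemannianMetric.IsLeviCivita

namespace SemiRiemannianMetric.HasConstantSectionalCurvature

/-- A nondegenerate plane at `x` is assumed: without one the sectional curvature says nothing
about the curvature at `x`. -/
lemma curvatureForm_eq {c : ℝ} (hc : g.HasConstantSectionalCurvature D c) (hD : g.IsLeviCivita D)
    {x : N} {u₀ v₀ : TangentSpace 𝓘(ℝ, E') x}
    (h₀ : g.val x u₀ u₀ * g.val x v₀ v₀ - g.val x u₀ v₀ ^ 2 ≠ 0)
    (hX : IsSmoothVF X) (hY : IsSmoothVF Y) (hZ : IsSmoothVF Z) (hW : IsSmoothVF W) :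
    curvatureForm g D X Y Z W x
      = c * (g.val x (Y x) (Z x) * g.val x (X x) (W x)
        - g.val x (X x) (Z x) * g.val x (Y x) (W x)) := by
  let metric : smoothVectorFields E' N →ₗ[ℝ] smoothVectorFields E' N →ₗ[ℝ] ℝ :=
    LinearMap.mk₂ ℝ (fun X Y ↦ g.val x (X.1 x) (Y.1 x)) (by simp) (by simp) (by simp) (by simp)
  have model := IsCurvatureLike.of_symmetric (b := metric) fun X Y ↦ g.symm x _ _
  have difference := (hD.isCurvatureLike_curvatureForm x).sub_const_mul model c
  obtain ⟨U, hU, rfl⟩ := exists_isSmoothVF_apply_eq u₀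
  obtain ⟨V, hV, rfl⟩ := exists_isSmoothVF_apply_eq v₀
  refine sub_eq_zero.1 <| difference.eq_zero_of_diag_or model (fun X Y ↦ ?_)
    (x₀ := ⟨U, hU⟩) (y₀ := ⟨V, hV⟩) ?_ ⟨X, hX⟩ ⟨Y, hY⟩ ⟨Z, hZ⟩ ⟨W, hW⟩
  · simp only [metric, LinearMap.mk₂_apply, curvatureForm]
    by_cases plane : g.val x (X.1 x) (X.1 x) * g.val x (Y.1 x) (Y.1 x)
        - g.val x (X.1 x) (Y.1 x) ^ 2 = 0
    · right
      rw [g.symm x (Y.1 x) (X.1 x)]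
      linear_combination plane
    · left
      rw [(div_eq_iff plane).1 (hc X.1 Y.1 X.2 Y.2 x plane), g.symm x (Y.1 x) (X.1 x)]
      ring
  · simp only [metric, LinearMap.mk₂_apply]
    rw [g.symm x (V x) (U x)]
    convert h₀ using 1
    ring

lemma curvature_eq {c : ℝ} (hc : g.HasConstantSectionalCurvature D c) (hD : g.IsLeviCivita D)
    {x : N} {u₀ v₀ : TangentSpace 𝓘(ℝ, E') x}
    (h₀ : g.val x u₀ u₀ * g.val x v₀ v₀ - g.val x u₀ v₀ ^ 2 ≠ 0)
    (hX : IsSmoothVF X) (hY : IsSmoothVF Y) (hZ : IsSmoothVF Z) :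
    curvature (fun Z y v ↦ D Z y v) X Y Z x
      = c • (g.val x (Y x) (Z x) • X x - g.val x (X x) (Z x) • Y x) := by
  refine sub_eq_zero.1 (g.nondegenerate x _ fun w ↦ ?_)
  obtain ⟨W, hW, rfl⟩ := exists_isSmoothVF_apply_eq w
  simpa only [map_sub, sub_apply, map_smul, smul_apply, smul_eq_mul, sub_eq_zero, curvatureForm]
    using
    hc.curvatureForm_eq hD h₀ hX hY hZ hW

end SemiRiemannianMetric.HasConstantSectionalCurvature

end Curvature

section CurvatureAlong

variable {E : Type*} [NormedAddCommGroup E] [NormedSpace ℝ E]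
  {M : Type*} [TopologicalSpace M] [ChartedSpace E M]
  {E' : Type*} [NormedAddCommGroup E'] [NormedSpace ℝ E'] [FiniteDimensional ℝ E']
  {N : Type*} [TopologicalSpace N] [ChartedSpace E' N] [IsManifold 𝓘(ℝ, E') ∞ N]
  {D : CovariantDerivative 𝓘(ℝ, E') E' (TangentSpace 𝓘(ℝ, E') : N → Type _)}
  {i : M → N} {p : M} {X Y : Π p : M, TangentSpace 𝓘(ℝ, E) p}
  {V W : Π p : M, TangentSpace 𝓘(ℝ, E') (i p)}

/-- The curvature `R(X, Y)V = ∇_X ∇_Y V - ∇_Y ∇_X V - ∇_[X,Y] V` of the pullback connection on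
`i*TN`, for a vector field `V` along `i`. -/
noncomputable def curvatureAlong
    (D : CovariantDerivative 𝓘(ℝ, E') E' (TangentSpace 𝓘(ℝ, E') : N → Type _)) (i : M → N)
    (X Y : Π p : M, TangentSpace 𝓘(ℝ, E) p) (V : Π p : M, TangentSpace 𝓘(ℝ, E') (i p)) (p : M) :
    TangentSpace 𝓘(ℝ, E') (i p) :=
  covAlong D i (fun q ↦ covAlong D i V q (Y q)) p (X p)
    - covAlong D i (fun q ↦ covAlong D i V q (X q)) p (Y p)
    - covAlong D i V p (VectorField.mlieBracket 𝓘(ℝ, E) X Y p)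

lemma curvatureAlong_congr (h : ∀ᶠ q in 𝓝 p, W q = V q) :
    curvatureAlong D i X Y W p = curvatureAlong D i X Y V p := by
  have first (Z : Π p : M, TangentSpace 𝓘(ℝ, E) p) :
      ∀ᶠ q in 𝓝 p, covAlong D i W q (Z q) = covAlong D i V q (Z q) :=
    (eventually_eventually_nhds.2 h).mono fun q hq ↦ covAlong_congr hq _
  simp only [curvatureAlong, covAlong_congr (first X), covAlong_congr (first Y), covAlong_congr h]

section Comp

variable {ι : Type*} [Fintype ι] {s : ι → Π x : N, TangentSpace 𝓘(ℝ, E') x}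
  {t : Π x : N, TangentSpace 𝓘(ℝ, E') x} {x y : ι → M → ℝ}

lemma covAlong_covAlong_comp (hD : ContMDiffCovariantDerivativeOn E' ∞ D.toFun Set.univ)
    (hi : ContMDiff 𝓘(ℝ, E) 𝓘(ℝ, E') ∞ i) (ht : IsSmoothVF t) (hs : ∀ j, IsSmoothVF (s j))
    (hy : ∀ j, ContMDiff 𝓘(ℝ, E) 𝓘(ℝ) ∞ (y j))
    (hX : diff i p (X p) = ∑ j, x j p • s j (i p))
    (hY : ∀ᶠ q in 𝓝 p, diff i q (Y q) = ∑ j, y j q • s j (i q)) :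
    covAlong D i (fun q ↦ covAlong D i (fun q ↦ t (i q)) q (Y q)) p (X p)
      = ∑ k, mvfderiv 𝓘(ℝ, E) (y k) p (X p) • D t (i p) (s k (i p))
        + ∑ k, ∑ l, (x l p * y k p) • D (fun z ↦ D t z (s k z)) (i p) (s l (i p)) := by
  have hi' := hi.mdifferentiable (by simp)
  have hDs (k) : IsSmoothVF (fun z ↦ D t z (s k z)) := ht.covariantDerivative hD (hs k)
  have expand : ∀ᶠ q in 𝓝 p, covAlong D i (fun q ↦ t (i q)) q (Y q)
      = ∑ k, y k q • D t (i q) (s k (i q)) := by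
    filter_upwards [hY] with q hq
    rw [covAlong_comp (hi' q) ht, hq, map_sum]
    simp only [map_smul]
  rw [covAlong_congr expand, covAlong_sum_smul _ (hi p) (fun k ↦ hy k p)
    (fun k ↦ (hDs k).smoothAlong_comp hi p), Finset.sum_add_distrib]
  congr 1
  refine Finset.sum_congr rfl fun k _ ↦ ?_
  rw [covAlong_comp (hi' p) (hDs k), hX, map_sum, Finset.smul_sum]
  exact Finset.sum_congr rfl fun l _ ↦ by rw [map_smul, smul_smul, mul_comm]

lemma curvatureAlong_comp [FiniteDimensional ℝ E] [T2Space M] [IsManifold 𝓘(ℝ, E) ∞ M] [T2Space N]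
    (hD : ContMDiffCovariantDerivativeOn E' ∞ D.toFun Set.univ)
    (hi : ContMDiff 𝓘(ℝ, E) 𝓘(ℝ, E') ∞ i) (ht : IsSmoothVF t) (hX : IsSmoothVF X)
    (hY : IsSmoothVF Y) (hs : ∀ j, IsSmoothVF (s j))
    (hx : ∀ j, ContMDiff 𝓘(ℝ, E) 𝓘(ℝ) ∞ (x j)) (hy : ∀ j, ContMDiff 𝓘(ℝ, E) 𝓘(ℝ) ∞ (y j))
    (hXs : ∀ᶠ q in 𝓝 p, diff i q (X q) = ∑ j, x j q • s j (i q))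
    (hYs : ∀ᶠ q in 𝓝 p, diff i q (Y q) = ∑ j, y j q • s j (i q)) :
    curvatureAlong D i X Y (fun q ↦ t (i q)) p
      = ∑ k, ∑ l, (x l p * y k p) • curvature (fun Z y v ↦ D Z y v) (s l) (s k) t (i p) := by
  have second := covAlong_covAlong_comp (D := D) hD hi ht hs hx hYs.self_of_nhds hXs
  rw [Finset.sum_comm (γ := ι)] at second
  simp only [curvatureAlong, curvature]
  rw [covAlong_covAlong_comp hD hi ht hs hy hXs.self_of_nhds hYs, second,
    covAlong_comp (hi.mdifferentiable (by simp) p) ht, diff_mlieBracket hi hX hY hs hx hy hXs hYs]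
  simp only [map_add, map_sub, map_sum, map_smul, smul_sub, sub_smul, Finset.sum_sub_distrib,
    mul_comm (y _ p)]
  abel

end Comp

variable [T2Space N]

lemma curvatureAlong_add [IsManifold 𝓘(ℝ, E) ∞ M]
    (hD : ContMDiffCovariantDerivativeOn E' ∞ D.toFun Set.univ)
    (hi : ContMDiff 𝓘(ℝ, E) 𝓘(ℝ, E') ∞ i) (hX : IsSmoothVF X) (hY : IsSmoothVF Y)
    (hV : SmoothAlong E i V) (hW : SmoothAlong E i W) :
    curvatureAlong D i X Y (fun q ↦ V q + W q) p
      = curvatureAlong D i X Y V p + curvatureAlong D i X Y W p := by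
  simp only [curvatureAlong, covAlong_add (hV _) (hW _)]
  rw [covAlong_add (hV.covAlong hD hi hY p) (hW.covAlong hD hi hY p),
    covAlong_add (hV.covAlong hD hi hX p) (hW.covAlong hD hi hX p)]
  abel

variable [FiniteDimensional ℝ E] [T2Space M] [IsManifold 𝓘(ℝ, E) ∞ M]

lemma curvatureAlong_smul (hD : ContMDiffCovariantDerivativeOn E' ∞ D.toFun Set.univ)
    (hi : ContMDiff 𝓘(ℝ, E) 𝓘(ℝ, E') ∞ i) (hX : IsSmoothVF X) (hY : IsSmoothVF Y)
    {f : M → ℝ} (hf : ContMDiff 𝓘(ℝ, E) 𝓘(ℝ) ∞ f) (hV : SmoothAlong E i V) :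
    curvatureAlong D i X Y (fun q ↦ f q • V q) p = f p • curvatureAlong D i X Y V p := by
  have hf' := hf.mdifferentiable (by simp)
  have second {A B : Π p : M, TangentSpace 𝓘(ℝ, E) p} (hB : IsSmoothVF B) :
      covAlong D i (fun q ↦ covAlong D i (fun q ↦ f q • V q) q (B q)) p (A p)
        = mvfderiv 𝓘(ℝ, E) (fun q ↦ mvfderiv 𝓘(ℝ, E) f q (B q)) p (A p) • V p
          + mvfderiv 𝓘(ℝ, E) f p (B p) • covAlong D i V p (A p)
          + (mvfderiv 𝓘(ℝ, E) f p (A p) • covAlong D i V p (B p)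
            + f p • covAlong D i (fun q ↦ covAlong D i V q (B q)) p (A p)) := by
    have hfB := contMDiff_mvfderiv_apply hf hB
    have hVB := hV.covAlong hD hi hB
    simp only [covAlong_smul (hf' _) (hV _)]
    rw [covAlong_add ((hV p).smul (hfB p)) ((hVB p).smul (hf p)),
      covAlong_smul (hfB.mdifferentiable (by simp) p) (hV p), covAlong_smul (hf' p) (hVB p)]
  simp only [curvatureAlong]
  rw [second hX, second hY, covAlong_smul (hf' p) (hV p), mvfderiv_mlieBracket hX hY hf]
  module

lemma SemiRiemannianMetric.HasConstantSectionalCurvature.curvatureAlong_eq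
    {g : SemiRiemannianMetric E' N} {c : ℝ} (hc : g.HasConstantSectionalCurvature D c)
    (hD : g.IsLeviCivita D) (hi : ContMDiff 𝓘(ℝ, E) 𝓘(ℝ, E') ∞ i)
    {u₀ v₀ : TangentSpace 𝓘(ℝ, E') (i p)}
    (h₀ : g.val (i p) u₀ u₀ * g.val (i p) v₀ v₀ - g.val (i p) u₀ v₀ ^ 2 ≠ 0)
    (hX : IsSmoothVF X) (hY : IsSmoothVF Y) (hV : SmoothAlong E i V) :
    curvatureAlong D i X Y V p
      = c • (g.val (i p) (diff i p (Y p)) (V p) • diff i p (X p)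
        - g.val (i p) (diff i p (X p)) (V p) • diff i p (Y p)) := by
  refine SmoothAlong.induction hi p (V := V) (P := fun V ↦ curvatureAlong D i X Y V p
    = c • (g.val (i p) (diff i p (Y p)) (V p) • diff i p (X p)
      - g.val (i p) (diff i p (X p)) (V p) • diff i p (Y p))) ?_ ?_ ?_ ?_ hV
  · intro V W _ _ h ih
    rw [curvatureAlong_congr h, h.self_of_nhds, ih]
  · intro V W hV hW ihV ihW
    rw [curvatureAlong_add hD.smooth hi hX hY hV hW, ihV, ihW, map_add, map_add]
    module
  · intro f V hf hV ih
    rw [curvatureAlong_smul hD.smooth hi hX hY hf hV, ih, map_smul, map_smul, smul_eq_mul,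
      smul_eq_mul]
    module
  · intro t ht
    obtain ⟨s, hs, hframe⟩ := exists_isSmoothVF_frame (E := E) hi p
    obtain ⟨x, hx, hXs⟩ := hframe _ (hX.smoothAlong_diff hi)
    obtain ⟨y, hy, hYs⟩ := hframe _ (hY.smoothAlong_diff hi)
    rw [curvatureAlong_comp hD.smooth hi ht hX hY hs hx hy hXs hYs, hXs.self_of_nhds,
      hYs.self_of_nhds]
    simp only [hc.curvature_eq hD h₀ (hs _) (hs _) ht, map_sum, map_smul, sum_apply, smul_apply,
      smul_eq_mul, smul_sub, Finset.sum_sub_distrib, Finset.smul_sum,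
      Finset.sum_mul, Finset.sum_smul, smul_smul]
    congr 1
    · rw [Finset.sum_comm]
      exact Finset.sum_congr rfl fun l _ ↦ Finset.sum_congr rfl fun k _ ↦ by congr 1; ring
    · exact Finset.sum_congr rfl fun k _ ↦ Finset.sum_congr rfl fun l _ ↦ by congr 1; ring

end CurvatureAlong

/-! ### Dual frames -/

section DualFrame

variable {E' : Type*} [NormedAddCommGroup E'] [NormedSpace ℝ E']
  {N : Type*} [TopologicalSpace N] [ChartedSpace E' N] [IsManifold 𝓘(ℝ, E') ∞ N]
  {M ι : Type*} {g : SemiRiemannianMetric E' N} {i : M → N}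
  {B : ι → Π p : M, TangentSpace 𝓘(ℝ, E') (i p)} {p : M}

variable (g B) in
/-- The Gram matrix of a family of vector fields along `i`. -/
noncomputable def gramMatrix (p : M) : Matrix ι ι ℝ :=
  .of fun j k ↦ g.val (i p) (B j p) (B k p)

variable [Fintype ι]

lemma gramMatrix_mulVec (a : ι → ℝ) (k : ι) :
    (gramMatrix g B p).mulVec a k = g.val (i p) (∑ j, a j • B j p) (B k p) := by
  simp only [gramMatrix, Matrix.mulVec, dotProduct, Matrix.of_apply, map_sum, map_smul, sum_apply,
    smul_apply, smul_eq_mul, g.symm _ (B k p), mul_comm]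

variable [DecidableEq ι]

variable (g B) in
/-- The family dual to the vector fields `B` along `i` with respect to `g`. It takes a junk value
where the Gram matrix of `B` is singular. -/
noncomputable def dualFrame (k : ι) (p : M) : TangentSpace 𝓘(ℝ, E') (i p) :=
  ∑ j, (gramMatrix g B p)⁻¹ j k • B j p

lemma det_gramMatrix_ne_zero [FiniteDimensional ℝ E'] (hι : Fintype.card ι = Module.finrank ℝ E')
    (hli : LinearIndependent ℝ fun j ↦ B j p) : (gramMatrix g B p).det ≠ 0 := by
  have : FiniteDimensional ℝ (TangentSpace 𝓘(ℝ, E') (i p)) :=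
    inferInstanceAs (FiniteDimensional ℝ E')
  intro hdet
  obtain ⟨a, ha, ha0⟩ := Matrix.exists_mulVec_eq_zero_iff.2 hdet
  have orthogonal : (g.val (i p) (∑ j, a j • B j p)).toLinearMap = 0 :=
    LinearMap.ext_on_range (hli.span_eq_top_of_card_eq_finrank' hι) fun k ↦
      (gramMatrix_mulVec a k).symm.trans (congrFun ha0 k)
  have relation := g.nondegenerate _ _ (LinearMap.congr_fun orthogonal)
  exact ha (funext (Fintype.linearIndependent_iff.1 hli a relation))

lemma apply_dualFrame (hp : (gramMatrix g B p).det ≠ 0) (k l : ι) :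
    g.val (i p) (dualFrame g B k p) (B l p) = if l = k then 1 else 0 := by
  rw [dualFrame, ← gramMatrix_mulVec, ← Matrix.one_apply, ← Matrix.mul_nonsing_inv _ hp.isUnit]
  rfl

variable {E : Type*} [NormedAddCommGroup E] [NormedSpace ℝ E]
  [TopologicalSpace M] [ChartedSpace E M]

lemma contMDiffAt_det {A : M → Matrix ι ι ℝ}
    (hA : ∀ j k, ContMDiffAt 𝓘(ℝ, E) 𝓘(ℝ) ∞ (fun q ↦ A q j k) p) :
    ContMDiffAt 𝓘(ℝ, E) 𝓘(ℝ) ∞ (fun q ↦ (A q).det) p := by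
  simp only [Matrix.det_apply']
  exact contMDiffAt_finsetSum fun σ _ ↦ contMDiffAt_const.mul
    (contMDiffAt_finsetProd fun j _ ↦ hA _ _)

lemma contMDiffAt_matrix_inv {A : M → Matrix ι ι ℝ}
    (hA : ∀ j k, ContMDiffAt 𝓘(ℝ, E) 𝓘(ℝ) ∞ (fun q ↦ A q j k) p) (hp : (A p).det ≠ 0) (j k : ι) :
    ContMDiffAt 𝓘(ℝ, E) 𝓘(ℝ) ∞ (fun q ↦ (A q)⁻¹ j k) p := by
  simp only [Matrix.inv_def, Matrix.smul_apply, Ring.inverse_eq_inv', smul_eq_mul,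
    Matrix.adjugate_apply]
  refine ((contMDiffAt_det hA).inv₀ hp).mul (contMDiffAt_det fun a b ↦ ?_)
  obtain rfl | h := eq_or_ne a k
  · simpa using contMDiffAt_const
  · simpa [Matrix.updateRow_ne h] using hA a b

lemma smoothAlongAt_dualFrame (hi : ContMDiffAt 𝓘(ℝ, E) 𝓘(ℝ, E') ∞ i p)
    (hB : ∀ j, SmoothAlong E i (B j)) (hp : (gramMatrix g B p).det ≠ 0) (k : ι) :
    SmoothAlongAt E i (dualFrame g B k) p :=
  .sum hi fun j _ ↦ (hB j p).smul (contMDiffAt_matrix_inv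
    (fun j k ↦ g.contMDiffAt_apply (hB j p) (hB k p)) hp j k)

variable [FiniteDimensional ℝ E']

lemma eventually_det_gramMatrix_ne_zero (hι : Fintype.card ι = Module.finrank ℝ E')
    (hB : ∀ j, SmoothAlong E i (B j)) (hli : LinearIndependent ℝ fun j ↦ B j p) :
    ∀ᶠ q in 𝓝 p, (gramMatrix g B q).det ≠ 0 :=
  (contMDiffAt_det fun j k ↦ g.contMDiffAt_apply (hB j p) (hB k p)).continuousAt.eventually_ne
    (det_gramMatrix_ne_zero hι hli)

omit [Fintype ι] in
lemma exists_dual_family [Finite ι] [T2Space N] (g : SemiRiemannianMetric E' N)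
    (hi : ContMDiff 𝓘(ℝ, E) 𝓘(ℝ, E') ∞ i)
    (hB : ∀ j, SmoothAlong E i (B j)) (hli : LinearIndependent ℝ fun j ↦ B j p) :
    ∃ B' : ι → Π p : M, TangentSpace 𝓘(ℝ, E') (i p),
      ∀ᶠ q in 𝓝 p, (∀ k, SmoothAlongAt E i (B' k) q) ∧
        ∀ k l, g.val (i q) (B' k q) (B l q) = if l = k then 1 else 0 := by
  classical
  have : FiniteDimensional ℝ (TangentSpace 𝓘(ℝ, E') (i p)) :=
    inferInstanceAs (FiniteDimensional ℝ E')
  have := Fintype.ofFinite ι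
  obtain ⟨Q, hQ⟩ := (Submodule.span ℝ (Set.range fun j ↦ B j p)).exists_isCompl
  let b := Module.finBasis ℝ Q
  choose Y hY hYb using fun j ↦ exists_isSmoothVF_apply_eq (E := E') (p := i p) (b j)
  let C : ι ⊕ Fin (Module.finrank ℝ Q) → Π p : M, TangentSpace 𝓘(ℝ, E') (i p) :=
    Sum.elim B fun j q ↦ Y j (i q)
  have hC : ∀ j, SmoothAlong E i (C j) := Sum.rec hB fun j ↦ (hY j).smoothAlong_comp hi
  have hCli : LinearIndependent ℝ fun j ↦ C j p := by
    have hCp : (fun j ↦ C j p) = Sum.elim (fun j ↦ B j p) fun j ↦ Q.subtype (b j) :=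
      funext (Sum.rec (fun _ ↦ rfl) hYb)
    rw [hCp]
    refine hli.sum_type (b.linearIndependent.map' Q.subtype Q.ker_subtype)
      (hQ.disjoint.mono_right ?_)
    exact Submodule.span_le.2 (Set.range_subset_iff.2 fun j ↦ (b j).2)
  have hcard : Fintype.card (ι ⊕ Fin (Module.finrank ℝ Q)) = Module.finrank ℝ E' := by
    rw [Fintype.card_sum, Fintype.card_fin, ← finrank_span_eq_card hli]
    exact Submodule.finrank_add_eq_of_isCompl hQ
  refine ⟨fun k ↦ dualFrame g C (.inl k),
    (eventually_det_gramMatrix_ne_zero hcard hC hCli).mono fun q hq ↦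
      ⟨fun k ↦ smoothAlongAt_dualFrame (hi q) hC hq _, fun k l ↦ ?_⟩⟩
  exact (apply_dualFrame hq (.inl k) (.inl l)).trans (if_congr Sum.inl.inj_iff rfl rfl)

end DualFrame

/-! ### Null normalizations of a lightlike hypersurface -/

section Distribution

variable {E : Type*} [NormedAddCommGroup E] [NormedSpace ℝ E]
  {M : Type*} [TopologicalSpace M] [ChartedSpace E M] [IsManifold 𝓘(ℝ, E) ∞ M]
  {k : ℕ} {S : Π p : M, Submodule ℝ (TangentSpace 𝓘(ℝ, E) p)}

lemma IsSmoothDistribution.finrank_eq (hS : IsSmoothDistribution k S) (p : M) :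
    Module.finrank ℝ (S p) = k := by
  obtain ⟨U, -, hp, s, -, hs⟩ := hS p
  rw [← (hs p hp).2, finrank_span_eq_card (hs p hp).1, Fintype.card_fin]

lemma IsSmoothDistribution.exists_isSmoothVF_span [FiniteDimensional ℝ E] [T2Space M]
    (hS : IsSmoothDistribution k S) (p : M) :
    ∃ s : Fin k → Π q : M, TangentSpace 𝓘(ℝ, E) q, (∀ j, IsSmoothVF (s j)) ∧
      ∀ᶠ q in 𝓝 p, LinearIndependent ℝ (fun j ↦ s j q) ∧
        Submodule.span ℝ (Set.range fun j ↦ s j q) = S q := by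
  obtain ⟨U, hU, hpU, s, hs, hsU⟩ := hS p
  obtain ⟨χ, hχ, hχ1, hχU⟩ := exists_contMDiff_eventually_eq_one (E := E) (hU.mem_nhds hpU)
  refine ⟨fun j q ↦ χ q • s j q, fun j ↦ smoothAlong_smul_of_tsupport (i := id) contMDiff_id hχ
    fun q hq ↦ (hs j).contMDiffAt (hU.mem_nhds (hχU hq)), ?_⟩
  filter_upwards [hχ1, hU.mem_nhds hpU] with q hχq hq
  simpa only [hχq, one_smul] using hsU q hq

end Distribution

section Immersion

variable {E : Type*} [NormedAddCommGroup E] [NormedSpace ℝ E] [FiniteDimensional ℝ E]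
  {M : Type*} [TopologicalSpace M] [T2Space M] [ChartedSpace E M] [IsManifold 𝓘(ℝ, E) ∞ M]
  {E' : Type*} [NormedAddCommGroup E'] [NormedSpace ℝ E'] [FiniteDimensional ℝ E']
  {N : Type*} [TopologicalSpace N] [T2Space N] [ChartedSpace E' N] [IsManifold 𝓘(ℝ, E') ∞ N]
  {i : M → N} {p : M}
  {u : Π p : M, TangentSpace 𝓘(ℝ, E) p} {V : Π p : M, TangentSpace 𝓘(ℝ, E') (i p)}

lemma smoothAlongAt_id_of_diff (g : SemiRiemannianMetric E' N)
    (hi : ContMDiff 𝓘(ℝ, E) 𝓘(ℝ, E') ∞ i)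
    (hinj : Function.Injective (diff (E := E) (E' := E') i p)) (hV : SmoothAlongAt E i V p)
    (hu : ∀ᶠ q in 𝓝 p, diff i q (u q) = V q) : SmoothAlongAt E id u p := by
  have (q : M) : FiniteDimensional ℝ (TangentSpace 𝓘(ℝ, E) q) :=
    inferInstanceAs (FiniteDimensional ℝ E)
  let b := Module.finBasis ℝ (TangentSpace 𝓘(ℝ, E) p)
  choose s hs hsb using fun j ↦ exists_isSmoothVF_apply_eq (b j)
  have hli : LinearIndependent ℝ fun j ↦ diff (E := E) (E' := E') i p (s j p) := by
    simp only [hsb]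
    exact b.linearIndependent.map' (diff i p).toLinearMap (LinearMap.ker_eq_bot.2 hinj)
  obtain ⟨B, hB⟩ := exists_dual_family g hi (fun j ↦ (hs j).smoothAlong_diff hi) hli
  have expand : ∀ᶠ q in 𝓝 p, u q = ∑ j, g.val (i q) (B j q) (V q) • s j q := by
    filter_upwards [hB, hu] with q hBq huq
    have coeff (a : Fin _ → ℝ) (k) :
        g.val (i q) (B k q) (diff i q (∑ l, a l • s l q)) = a k := by
      simp [hBq.2]
    have hsq : LinearIndependent ℝ fun j ↦ s j q := Fintype.linearIndependent_iff.2
      fun a ha k ↦ by rw [← coeff a k, ha, map_zero, map_zero]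
    have hspan := hsq.span_eq_top_of_card_eq_finrank' (Fintype.card_fin _)
    obtain ⟨a, ha⟩ := (Submodule.mem_span_range_iff_exists_fun ℝ).1
      (hspan ▸ Submodule.mem_top : u q ∈ Submodule.span ℝ (Set.range fun j ↦ s j q))
    rw [← huq, ← ha]
    simp only [coeff]
  exact (SmoothAlongAt.sum contMDiffAt_id fun j _ ↦
    SmoothAlongAt.smul (g.contMDiffAt_apply (hB.self_of_nhds.1 j) hV) (hs j p)).congr expand

end Immersion

section NullPair

variable {E : Type*} [NormedAddCommGroup E] [NormedSpace ℝ E]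
  {M : Type*} [TopologicalSpace M] [ChartedSpace E M]
  {E' : Type*} [NormedAddCommGroup E'] [NormedSpace ℝ E']
  {N : Type*} [TopologicalSpace N] [ChartedSpace E' N] [IsManifold 𝓘(ℝ, E') ∞ N]
  {g : SemiRiemannianMetric E' N} {i : M → N} {p : M}
  {ξ η : TangentSpace 𝓘(ℝ, E) p}

lemma apply_radical_left (hξ : ξ ∈ radical (E := E) g i p) (u : TangentSpace 𝓘(ℝ, E) p) :
    g.val (i p) (diff i p ξ) (diff i p u) = 0 := hξ u

lemma apply_radical_right (hξ : ξ ∈ radical (E := E) g i p) (u : TangentSpace 𝓘(ℝ, E) p) :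
    g.val (i p) (diff i p u) (diff i p ξ) = 0 :=
  (g.symm _ _ _).trans (hξ u)

variable [IsManifold 𝓘(ℝ, E) ∞ M]

lemma IsLightlikeHypersurface.exists_smul_eq_of_mem_radical
    (hi : IsLightlikeHypersurface (E := E) g i) (hξ : ξ ∈ Lightlike.radical (E := E) g i p)
    (h0 : ξ ≠ 0) (hη : η ∈ Lightlike.radical (E := E) g i p) : ∃ a : ℝ, a • ξ = η := by
  obtain ⟨a, ha⟩ := exists_smul_eq_of_finrank_eq_one (hi.radical.finrank_eq p)
    (x := ⟨ξ, hξ⟩) (by simpa only [ne_eq, Submodule.mk_eq_zero] using h0) ⟨η, hη⟩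
  exact ⟨a, congrArg Subtype.val ha⟩

variable {S : ScreenDistribution (E := E) g i} {n m : TangentSpace 𝓘(ℝ, E') (i p)}

lemma ScreenDistribution.mem_radical_of_forall_fiber {u : TangentSpace 𝓘(ℝ, E) p}
    (S : ScreenDistribution (E := E) g i)
    (hu : ∀ w ∈ S.fiber p, g.val (i p) (diff i p u) (diff i p w) = 0) :
    u ∈ radical (E := E) g i p := by
  intro w
  obtain ⟨r, hr, t, ht, rfl⟩ := Submodule.mem_sup.1
    ((S.isCompl p).sup_eq_top ▸ Submodule.mem_top : w ∈ radical (E := E) g i p ⊔ S.fiber p)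
  rw [inducedMetric, map_add, map_add, apply_radical_right hr, hu t ht, add_zero]

/-- A null normalization at a point: `ξ` is a radical vector, and `n` is the null transversal vector
orthogonal to the screen which is normalized by `g(n, ξ) = 1`. -/
structure IsNullPair (S : ScreenDistribution (E := E) g i) (ξ : TangentSpace 𝓘(ℝ, E) p)
    (n : TangentSpace 𝓘(ℝ, E') (i p)) : Prop where
  mem_radical : ξ ∈ radical (E := E) g i p
  null : g.val (i p) n n = 0
  screen : ∀ w ∈ S.fiber p, g.val (i p) n (diff i p w) = 0
  pairing : g.val (i p) n (diff i p ξ) = 1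

lemma isNullPair_sub_smul (hξ : ξ ∈ radical (E := E) g i p)
    (screen : ∀ w ∈ S.fiber p, g.val (i p) n (diff i p w) = 0)
    (pairing : g.val (i p) n (diff i p ξ) = 1) :
    IsNullPair S ξ (n - (g.val (i p) n n * 2⁻¹) • diff i p ξ) where
  mem_radical := hξ
  null := by
    simp only [map_sub, sub_apply, map_smul, smul_apply, smul_eq_mul, pairing,
      apply_radical_left hξ, g.symm _ (diff i p ξ) n]
    ring
  screen w hw := by simp [screen w hw, apply_radical_left hξ]
  pairing := by simp [pairing, apply_radical_left hξ]

namespace IsNullPair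

lemma ne_zero (h : IsNullPair S ξ n) : ξ ≠ 0 := by
  rintro rfl
  simpa using h.pairing

lemma nondegenerate_plane (h : IsNullPair S ξ n) :
    g.val (i p) (diff i p ξ) (diff i p ξ) * g.val (i p) n n - g.val (i p) (diff i p ξ) n ^ 2
      ≠ 0 := by
  rw [h.null, g.symm _ (diff i p ξ) n, h.pairing]
  norm_num

end IsNullPair

variable [FiniteDimensional ℝ E']

lemma IsLightlikeHypersurface.range_diff
    (hi : IsLightlikeHypersurface (E := E) g i) (hξ : ξ ∈ Lightlike.radical (E := E) g i p)
    (h0 : ξ ≠ 0) :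
    LinearMap.range (diff (E := E) (E' := E') i p).toLinearMap
      = LinearMap.ker (g.val (i p) (diff i p ξ)).toLinearMap := by
  have : FiniteDimensional ℝ (TangentSpace 𝓘(ℝ, E') (i p)) :=
    inferInstanceAs (FiniteDimensional ℝ E')
  have ne_zero : (g.val (i p) (diff i p ξ)).toLinearMap ≠ 0 := fun h ↦
    h0 (hi.injective p ((g.nondegenerate _ _ (LinearMap.congr_fun h)).trans (map_zero _).symm))
  refine Submodule.eq_of_le_of_finrank_eq ?_ ?_
  · rintro _ ⟨u, rfl⟩
    exact hξ u
  · have finrank_ker := Module.Dual.finrank_ker_add_one_of_ne_zero ne_zero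
    rw [LinearMap.finrank_range_of_inj (hi.injective p)]
    exact Nat.add_right_cancel (hi.codim.symm.trans finrank_ker.symm)

lemma IsLightlikeHypersurface.exists_diff_eq
    (hi : IsLightlikeHypersurface (E := E) g i) (hξ : ξ ∈ Lightlike.radical (E := E) g i p)
    (h0 : ξ ≠ 0) {v : TangentSpace 𝓘(ℝ, E') (i p)} (hv : g.val (i p) v (diff i p ξ) = 0) :
    ∃ u : TangentSpace 𝓘(ℝ, E) p, diff i p u = v :=
  (hi.range_diff hξ h0).ge ((g.symm _ _ _).trans hv)

namespace IsNullPair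

lemma unique (h : IsNullPair S ξ n) (hi : IsLightlikeHypersurface (E := E) g i)
    (h' : IsNullPair S ξ m) : m = n := by
  obtain ⟨u, hu⟩ := hi.exists_diff_eq h.mem_radical h.ne_zero (v := m - n)
    (by rw [map_sub, sub_apply, h.pairing, h'.pairing, sub_self])
  have hur : u ∈ radical (E := E) g i p := S.mem_radical_of_forall_fiber fun w hw ↦ by
    rw [hu, map_sub, sub_apply, h.screen w hw, h'.screen w hw, sub_self]
  obtain ⟨b, rfl⟩ := hi.exists_smul_eq_of_mem_radical h.mem_radical h.ne_zero hur
  have hm : m = n + b • diff i p ξ := by rw [← map_smul, hu, add_sub_cancel]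
  have hb : b = 0 := by
    have null := h'.null
    simp only [hm, map_add, map_smul, add_apply, smul_apply, smul_eq_mul, h.null, h.pairing,
      apply_radical_left h.mem_radical, g.symm _ (diff i p ξ) n] at null
    linarith
  rw [hm, hb, zero_smul, add_zero]

lemma transversal_eq (h : IsNullPair S ξ n) (hi : IsLightlikeHypersurface (E := E) g i) :
    transversal g i S p = Submodule.span ℝ {n} := by
  refine le_antisymm (Submodule.span_le.2 ?_) (Submodule.span_mono ?_)
  · rintro m ⟨null, screen, η, hη, pairing⟩
    obtain ⟨a, rfl⟩ := hi.exists_smul_eq_of_mem_radical h.mem_radical h.ne_zero hη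
    rw [map_smul, map_smul, smul_eq_mul] at pairing
    have hm : IsNullPair S ξ (a • m) := ⟨h.mem_radical, by simp [null],
      fun w hw ↦ by simp [screen w hw], by rwa [map_smul, smul_apply, smul_eq_mul]⟩
    rw [← h.unique hi hm, SetLike.mem_coe, Submodule.mem_span_singleton]
    exact ⟨a⁻¹, inv_smul_smul₀ (left_ne_zero_of_mul_eq_one pairing) m⟩
  · exact Set.singleton_subset_iff.2 ⟨h.null, h.screen, ξ, h.mem_radical, h.pairing⟩

lemma diff_tangentPart (h : IsNullPair S ξ n) (hi : IsLightlikeHypersurface (E := E) g i)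
    (v : TangentSpace 𝓘(ℝ, E') (i p)) :
    diff i p (tangentPart g i S p v) = v - g.val (i p) v (diff i p ξ) • n := by
  have exists_tangent : ∃ u : TangentSpace 𝓘(ℝ, E) p, v - diff i p u ∈ transversal g i S p := by
    obtain ⟨u, hu⟩ := hi.exists_diff_eq h.mem_radical h.ne_zero
      (v := v - g.val (i p) v (diff i p ξ) • n) (by simp [h.pairing])
    refine ⟨u, h.transversal_eq hi ▸ Submodule.mem_span_singleton.2
      ⟨g.val (i p) v (diff i p ξ), ?_⟩⟩
    rw [hu, sub_sub_cancel]
  rw [tangentPart, dif_pos exists_tangent]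
  obtain ⟨a, ha⟩ := Submodule.mem_span_singleton.1
    ((h.transversal_eq hi).le exists_tangent.choose_spec)
  have pair_ξ := congrArg (fun w ↦ g.val (i p) w (diff i p ξ)) ha
  simp only [map_smul, smul_apply, map_sub, sub_apply, h.pairing, smul_eq_mul, mul_one,
    apply_radical_right h.mem_radical, sub_zero] at pair_ξ
  rw [← pair_ξ, ha, sub_sub_cancel]

end IsNullPair

end NullPair

section NullFrame

variable {E : Type*} [NormedAddCommGroup E] [NormedSpace ℝ E]
  {M : Type*} [TopologicalSpace M] [ChartedSpace E M] [IsManifold 𝓘(ℝ, E) ∞ M]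
  {E' : Type*} [NormedAddCommGroup E'] [NormedSpace ℝ E']
  {N : Type*} [TopologicalSpace N] [ChartedSpace E' N] [IsManifold 𝓘(ℝ, E') ∞ N]
  {g : SemiRiemannianMetric E' N} {i : M → N} {S : ScreenDistribution (E := E) g i} {p : M}
  {Ξ : Π p : M, TangentSpace 𝓘(ℝ, E) p} {n : Π p : M, TangentSpace 𝓘(ℝ, E') (i p)}

/-- A smooth null normalization around `p`: the fields `Ξ` and `n` are globally smooth, but they are
required to span `Rad TM` and `tr(TM)` only near `p`, as these line bundles may be nontrivial. -/
structure IsNullFrameAt (S : ScreenDistribution (E := E) g i)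
    (Ξ : Π q : M, TangentSpace 𝓘(ℝ, E) q) (n : Π q : M, TangentSpace 𝓘(ℝ, E') (i q)) (p : M) :
    Prop where
  smooth_radical : IsSmoothVF Ξ
  smooth_transversal : SmoothAlong E i n
  isNullPair : ∀ᶠ q in 𝓝 p, IsNullPair S (Ξ q) (n q)

lemma IsNullFrameAt.eventually (h : IsNullFrameAt S Ξ n p) :
    ∀ᶠ q in 𝓝 p, IsNullFrameAt S Ξ n q :=
  h.isNullPair.eventually_nhds.mono fun _ hq ↦ ⟨h.smooth_radical, h.smooth_transversal, hq⟩

variable [FiniteDimensional ℝ E] [T2Space M]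

lemma ScreenDistribution.exists_adapted_frame (S : ScreenDistribution (E := E) g i)
    (hi : IsLightlikeHypersurface (E := E) g i) (p : M) :
    ∃ s : Fin 1 ⊕ Fin (Module.finrank ℝ E - 1) → Π q : M, TangentSpace 𝓘(ℝ, E) q,
      (∀ j, IsSmoothVF (s j)) ∧ LinearIndependent ℝ (fun j ↦ s j p) ∧
      ∀ᶠ q in 𝓝 p, s (.inl 0) q ∈ radical g i q ∧
        Submodule.span ℝ (Set.range fun j ↦ s (.inr j) q) = S.fiber q := by
  obtain ⟨r, hr, r_span⟩ := hi.radical.exists_isSmoothVF_span p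
  obtain ⟨t, ht, t_span⟩ := S.smooth.exists_isSmoothVF_span p
  refine ⟨Sum.elim r t, Sum.rec hr ht, ?_, ?_⟩
  · obtain ⟨r_li, r_eq⟩ := r_span.self_of_nhds
    obtain ⟨t_li, t_eq⟩ := t_span.self_of_nhds
    exact (funext (Sum.rec (fun _ ↦ rfl) fun _ ↦ rfl) :
      (fun j ↦ Sum.elim r t j p) = Sum.elim (r · p) (t · p)) ▸
      r_li.sum_type t_li (by rw [r_eq, t_eq]; exact (S.isCompl p).disjoint)
  · filter_upwards [r_span, t_span] with q hr_q ht_q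
    exact ⟨hr_q.2 ▸ Submodule.subset_span ⟨0, rfl⟩, ht_q.2⟩

variable [T2Space N] [FiniteDimensional ℝ E']

lemma exists_isNullFrameAt (hi : IsLightlikeHypersurface (E := E) g i)
    (S : ScreenDistribution (E := E) g i) (p : M) :
    ∃ (Ξ : Π q : M, TangentSpace 𝓘(ℝ, E) q) (n : Π q : M, TangentSpace 𝓘(ℝ, E') (i q)),
      IsNullFrameAt S Ξ n p := by
  obtain ⟨s, hs, s_li, hs_span⟩ := S.exists_adapted_frame hi p
  obtain ⟨β, hβ⟩ := exists_dual_family g hi.contMDiff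
    (fun j ↦ (hs j).smoothAlong_diff hi.contMDiff)
    (s_li.map' (diff i p).toLinearMap (LinearMap.ker_eq_bot.2 (hi.injective p)))
  -- The vector field dual to the radical direction pairs correctly but need not be null; adding a
  -- multiple of the radical direction makes it null and changes no other pairing.
  let n₀ q := β (.inl 0) q
  let n q := n₀ q - (g.val (i q) (n₀ q) (n₀ q) * 2⁻¹) • diff i q (s (.inl 0) q)
  have n_isNullPair : ∀ᶠ q in 𝓝 p, IsNullPair S (s (.inl 0) q) (n q) := by
    filter_upwards [hβ, hs_span] with q dual span
    refine isNullPair_sub_smul span.1 (fun w hw ↦ ?_) ((dual.2 _ _).trans (if_pos rfl))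
    rw [← span.2] at hw
    obtain ⟨a, rfl⟩ := (Submodule.mem_span_range_iff_exists_fun ℝ).1 hw
    simp [n₀, dual.2]
  have n_smooth : ∀ᶠ q in 𝓝 p, SmoothAlongAt E i n q := by
    filter_upwards [hβ] with q dual
    exact (dual.1 _).sub (SmoothAlongAt.smul
      ((g.contMDiffAt_apply (dual.1 _) (dual.1 _)).mul contMDiffAt_const)
      ((hs (.inl 0)).smoothAlong_diff hi.contMDiff q))
  obtain ⟨χ, hχ, χ_one, hχ_supp⟩ := exists_contMDiff_eventually_eq_one (E := E) n_smooth
  refine ⟨s (.inl 0), fun q ↦ χ q • n q, hs _,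
    smoothAlong_smul_of_tsupport hi.contMDiff hχ fun q hq ↦ hχ_supp hq, ?_⟩
  filter_upwards [χ_one, n_isNullPair] with q hq
  rw [hq, one_smul]
  exact id

end NullFrame

/-! ### The induced connection -/

section InducedConnection

variable {E : Type*} [NormedAddCommGroup E] [NormedSpace ℝ E]
  {M : Type*} [TopologicalSpace M] [ChartedSpace E M] [IsManifold 𝓘(ℝ, E) ∞ M]
  {E' : Type*} [NormedAddCommGroup E'] [NormedSpace ℝ E'] [FiniteDimensional ℝ E']
  {N : Type*} [TopologicalSpace N] [ChartedSpace E' N] [IsManifold 𝓘(ℝ, E') ∞ N]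
  {g : SemiRiemannianMetric E' N}
  {D : CovariantDerivative 𝓘(ℝ, E') E' (TangentSpace 𝓘(ℝ, E') : N → Type _)}
  {i : M → N} {S : ScreenDistribution (E := E) g i} {p : M}
  {W X Y Z Ξ : Π p : M, TangentSpace 𝓘(ℝ, E) p} {n : Π p : M, TangentSpace 𝓘(ℝ, E') (i p)}

lemma inducedConnection_congr (h : ∀ᶠ q in 𝓝 p, X q = Y q) (u : TangentSpace 𝓘(ℝ, E) p) :
    inducedConnection g D i S X p u = inducedConnection g D i S Y p u :=
  congrArg (tangentPart g i S p) (covAlong_congr (h.mono fun _ hq ↦ by rw [hq]) u)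

namespace IsNullPair

variable {ξ : TangentSpace 𝓘(ℝ, E) p} {m : TangentSpace 𝓘(ℝ, E') (i p)}

lemma diff_inducedConnection (h : IsNullPair S ξ m) (hi : IsLightlikeHypersurface (E := E) g i)
    (u : TangentSpace 𝓘(ℝ, E) p) :
    diff i p (inducedConnection g D i S Y p u) = covAlong D i (fun q ↦ diff i q (Y q)) p u
      - g.val (i p) (covAlong D i (fun q ↦ diff i q (Y q)) p u) (diff i p ξ) • m :=
  h.diff_tangentPart hi _

lemma secondFundamentalForm_eq (h : IsNullPair S ξ m)
    (hi : IsLightlikeHypersurface (E := E) g i) :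
    secondFundamentalForm g D i S X Y p
      = g.val (i p) (covAlong D i (fun q ↦ diff i q (Y q)) p (X p)) (diff i p ξ) • m := by
  rw [secondFundamentalForm, h.diff_inducedConnection hi, sub_sub_cancel]

lemma apply_inducedConnection (h : IsNullPair S ξ m) (hi : IsLightlikeHypersurface (E := E) g i)
    (u : TangentSpace 𝓘(ℝ, E) p) :
    g.val (i p) (diff i p (inducedConnection g D i S Y p u)) m
      = g.val (i p) (covAlong D i (fun q ↦ diff i q (Y q)) p u) m := by
  simp [h.diff_inducedConnection hi, h.null]

end IsNullPair

lemma IsTotallyGeodesic.diff_inducedConnection [FiniteDimensional ℝ E] [T2Space M]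
    (hS : IsTotallyGeodesic g D i S) (hY : IsSmoothVF Y) (u : TangentSpace 𝓘(ℝ, E) p) :
    diff i p (inducedConnection g D i S Y p u) = covAlong D i (fun q ↦ diff i q (Y q)) p u := by
  obtain ⟨X, hX, rfl⟩ := exists_isSmoothVF_apply_eq u
  exact (sub_eq_zero.1 (hS X Y hX hY p)).symm

variable [T2Space N]

namespace IsNullFrameAt

variable (hD : g.IsLeviCivita D) (hi : IsLightlikeHypersurface (E := E) g i)
include hD hi

lemma apply_covAlong_radical (h : IsNullFrameAt S Ξ n p) (hY : IsSmoothVF Y)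
    (u : TangentSpace 𝓘(ℝ, E) p) :
    g.val (i p) (covAlong D i (fun q ↦ diff i q (Y q)) p u) (diff i p (Ξ p))
      = -g.val (i p) (diff i p (Y p)) (covAlong D i (fun q ↦ diff i q (Ξ q)) p u) := by
  have orthogonal : ∀ᶠ q in 𝓝 p, g.val (i q) (diff i q (Y q)) (diff i q (Ξ q)) = 0 :=
    h.isNullPair.mono fun q hq ↦ apply_radical_right hq.mem_radical _
  have metric := hD.metric_along hi.contMDiff (hY.smoothAlong_diff hi.contMDiff)
    (h.smooth_radical.smoothAlong_diff hi.contMDiff) u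
  rw [mvfderiv_congr orthogonal, mvfderiv_const, zero_apply] at metric
  exact eq_neg_of_add_eq_zero_left metric.symm

lemma diff_inducedConnection_radical (h : IsNullFrameAt S Ξ n p) (u : TangentSpace 𝓘(ℝ, E) p) :
    diff i p (inducedConnection g D i S Ξ p u) = covAlong D i (fun q ↦ diff i q (Ξ q)) p u := by
  have metric := h.apply_covAlong_radical hD hi h.smooth_radical u
  rw [g.symm _ (diff i p (Ξ p))] at metric
  rw [h.isNullPair.self_of_nhds.diff_inducedConnection hi, self_eq_neg.1 metric, zero_smul,
    sub_zero]

lemma diff_curvature_radical (h : IsNullFrameAt S Ξ n p) :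
    diff i p (curvature (inducedConnection g D i S) X Y Ξ p)
      = curvatureAlong D i X Y (fun q ↦ diff i q (Ξ q)) p
        - g.val (i p) (curvatureAlong D i X Y (fun q ↦ diff i q (Ξ q)) p) (diff i p (Ξ p))
          • n p := by
  have second (A : Π p : M, TangentSpace 𝓘(ℝ, E) p) (u : TangentSpace 𝓘(ℝ, E) p) :
      covAlong D i (fun q ↦ diff i q (inducedConnection g D i S Ξ q (A q))) p u
        = covAlong D i (fun q ↦ covAlong D i (fun q ↦ diff i q (Ξ q)) q (A q)) p u :=
    covAlong_congr (h.eventually.mono fun q hq ↦ hq.diff_inducedConnection_radical hD hi _) u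
  simp only [curvature, curvatureAlong, map_sub, sub_apply, second,
    h.isNullPair.self_of_nhds.diff_inducedConnection hi]
  module

lemma apply_covAlong_transversal (h : IsNullFrameAt S Ξ n p) (u : TangentSpace 𝓘(ℝ, E) p) :
    g.val (i p) (covAlong D i n p u) (n p) = 0 := by
  have metric := hD.metric_along hi.contMDiff h.smooth_transversal h.smooth_transversal u
  rw [mvfderiv_congr (h.isNullPair.mono fun q hq ↦ hq.null), mvfderiv_const, zero_apply,
    g.symm _ (n p)] at metric
  linarith

lemma apply_covAlong_inducedConnection (h : IsNullFrameAt S Ξ n p) (hX : IsSmoothVF X)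
    (hZ : IsSmoothVF Z) (u : TangentSpace 𝓘(ℝ, E) p) :
    g.val (i p)
        (covAlong D i (fun q ↦ diff i q (inducedConnection g D i S Z q (X q))) p u) (n p)
      = g.val (i p) (covAlong D i (fun q ↦ covAlong D i (fun q ↦ diff i q (Z q)) q (X q)) p u)
        (n p) := by
  have hV := (hZ.smoothAlong_diff hi.contMDiff).covAlong hD.smooth hi.contMDiff hX
  let B q := -g.val (i q) (covAlong D i (fun q ↦ diff i q (Z q)) q (X q)) (diff i q (Ξ q))
  have hB : ContMDiffAt 𝓘(ℝ, E) 𝓘(ℝ) ∞ B p :=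
    (g.contMDiffAt_apply (hV p) (h.smooth_radical.smoothAlong_diff hi.contMDiff p)).neg
  have gauss : ∀ᶠ q in 𝓝 p, diff i q (inducedConnection g D i S Z q (X q))
      = covAlong D i (fun q ↦ diff i q (Z q)) q (X q) + B q • n q :=
    h.isNullPair.mono fun q hq ↦ by
      rw [hq.diff_inducedConnection hi, neg_smul, sub_eq_add_neg]
  have hn := h.smooth_transversal p
  rw [covAlong_congr gauss, covAlong_add (hV p) (hn.smul hB),
    covAlong_smul (hB.mdifferentiableAt (by simp)) hn]
  simp [h.apply_covAlong_transversal hD hi, h.isNullPair.self_of_nhds.null]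

lemma apply_curvature_transversal (h : IsNullFrameAt S Ξ n p) (hX : IsSmoothVF X)
    (hY : IsSmoothVF Y) (hZ : IsSmoothVF Z) :
    g.val (i p) (diff i p (curvature (inducedConnection g D i S) X Y Z p)) (n p)
      = g.val (i p) (curvatureAlong D i X Y (fun q ↦ diff i q (Z q)) p) (n p) := by
  simp only [curvature, curvatureAlong, map_sub, sub_apply,
    h.isNullPair.self_of_nhds.apply_inducedConnection hi,
    h.apply_covAlong_inducedConnection hD hi hX hZ, h.apply_covAlong_inducedConnection hD hi hY hZ]

end IsNullFrameAt

variable [FiniteDimensional ℝ E] [T2Space M]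

lemma inducedConnection_zero (hi : IsLightlikeHypersurface (E := E) g i)
    (u : TangentSpace 𝓘(ℝ, E) p) :
    inducedConnection g D i S (fun q ↦ (0 : TangentSpace 𝓘(ℝ, E) q)) p u = 0 := by
  obtain ⟨Ξ, n, h⟩ := exists_isNullFrameAt hi S p
  refine hi.injective p ?_
  rw [h.isNullPair.self_of_nhds.diff_inducedConnection hi]
  simp only [map_zero, covAlong_zero (hi.contMDiff.mdifferentiable (by simp) p), zero_apply,
    zero_smul, sub_zero]

lemma inducedConnection_add (hi : IsLightlikeHypersurface (E := E) g i) (hX : IsSmoothVF X)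
    (hY : IsSmoothVF Y) (u : TangentSpace 𝓘(ℝ, E) p) :
    inducedConnection g D i S (fun q ↦ X q + Y q) p u
      = inducedConnection g D i S X p u + inducedConnection g D i S Y p u := by
  obtain ⟨Ξ, n, h⟩ := exists_isNullFrameAt hi S p
  refine hi.injective p ?_
  simp only [map_add, h.isNullPair.self_of_nhds.diff_inducedConnection hi,
    covAlong_add (hX.smoothAlong_diff hi.contMDiff p) (hY.smoothAlong_diff hi.contMDiff p),
    add_apply]
  module

lemma inducedConnection_smul (hi : IsLightlikeHypersurface (E := E) g i) {f : M → ℝ}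
    (hf : MDifferentiableAt 𝓘(ℝ, E) 𝓘(ℝ) f p) (hX : IsSmoothVF X) (u : TangentSpace 𝓘(ℝ, E) p) :
    inducedConnection g D i S (fun q ↦ f q • X q) p u
      = mvfderiv 𝓘(ℝ, E) f p u • X p + f p • inducedConnection g D i S X p u := by
  obtain ⟨Ξ, n, h⟩ := exists_isNullFrameAt hi S p
  have hp := h.isNullPair.self_of_nhds
  refine hi.injective p ?_
  simp only [map_add, map_smul, hp.diff_inducedConnection hi,
    covAlong_smul hf (hX.smoothAlong_diff hi.contMDiff p), add_apply, smul_apply, smul_eq_mul,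
    apply_radical_right hp.mem_radical]
  module

lemma isSmoothVF_inducedConnection (hD : g.IsLeviCivita D)
    (hi : IsLightlikeHypersurface (E := E) g i) (S : ScreenDistribution (E := E) g i)
    (hY : IsSmoothVF Y) (hX : IsSmoothVF X) :
    IsSmoothVF (fun q ↦ inducedConnection g D i S Y q (X q)) := by
  intro p
  obtain ⟨Ξ, n, h⟩ := exists_isNullFrameAt hi S p
  have hV := (hY.smoothAlong_diff hi.contMDiff).covAlong hD.smooth hi.contMDiff hX
  refine smoothAlongAt_id_of_diff g hi.contMDiff (hi.injective p)
    (V := fun q ↦ covAlong D i (fun q ↦ diff i q (Y q)) q (X q)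
      - g.val (i q) (covAlong D i (fun q ↦ diff i q (Y q)) q (X q)) (diff i q (Ξ q)) • n q)
    ?_ (h.isNullPair.mono fun q hq ↦ hq.diff_inducedConnection hi _)
  exact (hV p).sub (SmoothAlongAt.smul
    (g.contMDiffAt_apply (hV p) (h.smooth_radical.smoothAlong_diff hi.contMDiff p))
    (h.smooth_transversal p))

/-! ### Totally geodesic hypersurfaces -/

namespace IsTotallyGeodesic

lemma mvfderiv_inducedMetric (hS : IsTotallyGeodesic g D i S) (hD : g.IsLeviCivita D)
    (hi : ContMDiff 𝓘(ℝ, E) 𝓘(ℝ, E') ∞ i) (hX : IsSmoothVF X) (hY : IsSmoothVF Y)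
    (u : TangentSpace 𝓘(ℝ, E) p) :
    mvfderiv 𝓘(ℝ, E) (fun q ↦ inducedMetric g i q (X q) (Y q)) p u
      = inducedMetric g i p (inducedConnection g D i S X p u) (Y p)
        + inducedMetric g i p (X p) (inducedConnection g D i S Y p u) := by
  simp only [inducedMetric, hS.diff_inducedConnection hX, hS.diff_inducedConnection hY]
  exact hD.metric_along hi (hX.smoothAlong_diff hi) (hY.smoothAlong_diff hi) u

lemma inducedConnection_inducedMetric_smul (hS : IsTotallyGeodesic g D i S)
    (hD : g.IsLeviCivita D) (hi : IsLightlikeHypersurface (E := E) g i) (a : ℝ)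
    (hX : IsSmoothVF X) (hY : IsSmoothVF Y) (hZ : IsSmoothVF Z) (u : TangentSpace 𝓘(ℝ, E) p) :
    inducedConnection g D i S (fun q ↦ (a * inducedMetric g i q (X q) (Y q)) • Z q) p u
      = (a * (inducedMetric g i p (inducedConnection g D i S X p u) (Y p)
          + inducedMetric g i p (X p) (inducedConnection g D i S Y p u))) • Z p
        + (a * inducedMetric g i p (X p) (Y p)) • inducedConnection g D i S Z p u := by
  have metric : MDifferentiableAt 𝓘(ℝ, E) 𝓘(ℝ) (fun q ↦ inducedMetric g i q (X q) (Y q)) p :=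
    (g.contMDiffAt_apply (hX.smoothAlong_diff hi.contMDiff p)
      (hY.smoothAlong_diff hi.contMDiff p)).mdifferentiableAt (by simp)
  rw [inducedConnection_smul hi (f := fun q ↦ a * inducedMetric g i q (X q) (Y q))
      (mdifferentiableAt_const.mul metric) hZ,
    mvfderiv_fun_mul mdifferentiableAt_const metric, mvfderiv_const]
  simp only [smul_apply, smul_zero, add_zero, smul_eq_mul,
    hS.mvfderiv_inducedMetric hD hi.contMDiff hX hY]

lemma diff_curvature (hS : IsTotallyGeodesic g D i S) (hD : g.IsLeviCivita D)
    (hi : IsLightlikeHypersurface (E := E) g i) (hX : IsSmoothVF X) (hY : IsSmoothVF Y)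
    (hZ : IsSmoothVF Z) (p : M) :
    diff i p (curvature (inducedConnection g D i S) X Y Z p)
      = curvatureAlong D i X Y (fun q ↦ diff i q (Z q)) p := by
  simp only [curvature, curvatureAlong, map_sub, hS.diff_inducedConnection hZ,
    hS.diff_inducedConnection (isSmoothVF_inducedConnection hD hi S hZ hX),
    hS.diff_inducedConnection (isSmoothVF_inducedConnection hD hi S hZ hY)]

lemma curvature_eq (hS : IsTotallyGeodesic g D i S) (hD : g.IsLeviCivita D)
    (hi : IsLightlikeHypersurface (E := E) g i) {c : ℝ}
    (hc : g.HasConstantSectionalCurvature D c) (hX : IsSmoothVF X) (hY : IsSmoothVF Y)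
    (hZ : IsSmoothVF Z) (p : M) :
    curvature (inducedConnection g D i S) X Y Z p
      = (c * inducedMetric g i p (Y p) (Z p)) • X p
        + (-c * inducedMetric g i p (X p) (Z p)) • Y p := by
  obtain ⟨Ξ, n, h⟩ := exists_isNullFrameAt hi S p
  refine hi.injective p ?_
  rw [hS.diff_curvature hD hi hX hY hZ, hc.curvatureAlong_eq hD hi.contMDiff
    h.isNullPair.self_of_nhds.nondegenerate_plane hX hY (hZ.smoothAlong_diff hi.contMDiff)]
  simp only [map_add, map_smul, inducedMetric]
  module

lemma covDerivCurvature_eq_zero (hS : IsTotallyGeodesic g D i S) (hD : g.IsLeviCivita D)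
    (hi : IsLightlikeHypersurface (E := E) g i) {c : ℝ}
    (hc : g.HasConstantSectionalCurvature D c) (hW : IsSmoothVF W) (hX : IsSmoothVF X)
    (hY : IsSmoothVF Y) (hZ : IsSmoothVF Z) (p : M) :
    covDerivCurvature (inducedConnection g D i S) W X Y Z p = 0 := by
  have smooth_nabla {A : Π p : M, TangentSpace 𝓘(ℝ, E) p} (hA : IsSmoothVF A) :
      IsSmoothVF (fun q ↦ inducedConnection g D i S A q (W q)) :=
    isSmoothVF_inducedConnection hD hi S hA hW
  have smooth_term (a : ℝ) {A B C : Π p : M, TangentSpace 𝓘(ℝ, E) p} (hA : IsSmoothVF A)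
      (hB : IsSmoothVF B) (hC : IsSmoothVF C) :
      IsSmoothVF (fun q ↦ (a * inducedMetric g i q (A q) (B q)) • C q) := fun q ↦
    SmoothAlongAt.smul (contMDiffAt_const.mul (g.contMDiffAt_apply
      (hA.smoothAlong_diff hi.contMDiff q) (hB.smoothAlong_diff hi.contMDiff q))) (hC q)
  rw [covDerivCurvature, funext (hS.curvature_eq hD hi hc hX hY hZ),
    inducedConnection_add hi (smooth_term c hY hZ hX) (smooth_term (-c) hX hZ hY),
    hS.inducedConnection_inducedMetric_smul hD hi c hY hZ hX,
    hS.inducedConnection_inducedMetric_smul hD hi (-c) hX hZ hY,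
    hS.curvature_eq hD hi hc (smooth_nabla hX) hY hZ,
    hS.curvature_eq hD hi hc hX (smooth_nabla hY) hZ,
    hS.curvature_eq hD hi hc hX hY (smooth_nabla hZ)]
  module

lemma isLocallySymmetric (hS : IsTotallyGeodesic g D i S) (hD : g.IsLeviCivita D)
    (hi : IsLightlikeHypersurface (E := E) g i) {c : ℝ}
    (hc : g.HasConstantSectionalCurvature D c) : IsLocallySymmetric g D i S := by
  intro W X Y Z hW hX hY hZ p
  rw [hS.covDerivCurvature_eq_zero hD hi hc hW hX hY hZ]
  simp [inducedMetric]

end IsTotallyGeodesic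

/-! ### Locally symmetric hypersurfaces -/

section LocallySymmetric

variable (hD : g.IsLeviCivita D) (hi : IsLightlikeHypersurface (E := E) g i)
  {c : ℝ} (hc : g.HasConstantSectionalCurvature D c)
include hD hi hc

namespace IsNullFrameAt

lemma curvature_radical_eq_zero (h : IsNullFrameAt S Ξ n p) (hX : IsSmoothVF X)
    (hY : IsSmoothVF Y) : curvature (inducedConnection g D i S) X Y Ξ p = 0 := by
  have hp := h.isNullPair.self_of_nhds
  refine hi.injective p ?_
  rw [h.diff_curvature_radical hD hi, hc.curvatureAlong_eq hD hi.contMDiff hp.nondegenerate_plane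
    hX hY (h.smooth_radical.smoothAlong_diff hi.contMDiff)]
  simp [apply_radical_right hp.mem_radical]

lemma inducedConnection_curvature_radical (h : IsNullFrameAt S Ξ n p) (hX : IsSmoothVF X)
    (hY : IsSmoothVF Y) (u : TangentSpace 𝓘(ℝ, E) p) :
    inducedConnection g D i S (curvature (inducedConnection g D i S) X Y Ξ) p u = 0 :=
  (inducedConnection_congr (h.eventually.mono fun _ hq ↦
    hq.curvature_radical_eq_zero hD hi hc hX hY) u).trans (inducedConnection_zero hi u)

lemma apply_covDerivCurvature_radical (h : IsNullFrameAt S Ξ n p) (hW : IsSmoothVF W)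
    (hY : IsSmoothVF Y) :
    g.val (i p) (diff i p (covDerivCurvature (inducedConnection g D i S) W Ξ Y Ξ p)) (n p)
      = -(c * g.val (i p) (diff i p (Y p)) (covAlong D i (fun q ↦ diff i q (Ξ q)) p (W p))) := by
  have hp := h.isNullPair.self_of_nhds
  have smooth_nabla {A : Π p : M, TangentSpace 𝓘(ℝ, E) p} (hA : IsSmoothVF A) :
      IsSmoothVF (fun q ↦ inducedConnection g D i S A q (W q)) :=
    isSmoothVF_inducedConnection hD hi S hA hW
  have hnabla := smooth_nabla h.smooth_radical
  have reduce : covDerivCurvature (inducedConnection g D i S) W Ξ Y Ξ p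
      = -curvature (inducedConnection g D i S) Ξ Y
          (fun q ↦ inducedConnection g D i S Ξ q (W q)) p := by
    rw [covDerivCurvature, h.inducedConnection_curvature_radical hD hi hc h.smooth_radical hY,
      h.curvature_radical_eq_zero hD hi hc hnabla hY,
      h.curvature_radical_eq_zero hD hi hc h.smooth_radical (smooth_nabla hY)]
    simp only [sub_zero, zero_sub]
  rw [reduce, map_neg, map_neg, neg_apply,
    h.apply_curvature_transversal hD hi h.smooth_radical hY hnabla,
    hc.curvatureAlong_eq hD hi.contMDiff hp.nondegenerate_plane h.smooth_radical hY
      (hnabla.smoothAlong_diff hi.contMDiff), h.diff_inducedConnection_radical hD hi]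
  simp [← h.diff_inducedConnection_radical hD hi, apply_radical_left hp.mem_radical,
    g.symm _ (diff i p (Ξ p)) (n p), hp.pairing]

end IsNullFrameAt

lemma IsLocallySymmetric.isTotallyGeodesic (hS : IsLocallySymmetric g D i S) (hc0 : c ≠ 0) :
    IsTotallyGeodesic g D i S := by
  intro W Y hW hY p
  obtain ⟨Ξ, n, h⟩ := exists_isNullFrameAt hi S p
  have hp := h.isNullPair.self_of_nhds
  have pairing := (hS W Ξ Y Ξ hW h.smooth_radical hY h.smooth_radical p).2 (n p)
    ((hp.transversal_eq hi).ge (Submodule.mem_span_singleton_self _))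
  rw [h.apply_covDerivCurvature_radical hD hi hc hW hY, neg_eq_zero] at pairing
  rw [hp.secondFundamentalForm_eq hi, h.apply_covAlong_radical hD hi hY,
    (mul_eq_zero.1 pairing).resolve_left hc0, neg_zero, zero_smul]

end LocallySymmetric

end InducedConnection

end Lightlike

theorem proposition5p1_general
    {E : Type*} [NormedAddCommGroup E] [NormedSpace ℝ E] [FiniteDimensional ℝ E]
    {M : Type*} [TopologicalSpace M] [T2Space M]
    [ChartedSpace E M] [IsManifold 𝓘(ℝ, E) ∞ M]
    {E' : Type*} [NormedAddCommGroup E'] [NormedSpace ℝ E'] [FiniteDimensional ℝ E']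
    {N : Type*} [TopologicalSpace N] [T2Space N]
    [ChartedSpace E' N] [IsManifold 𝓘(ℝ, E') ∞ N]
    (g : Lightlike.SemiRiemannianMetric E' N)
    (D : CovariantDerivative 𝓘(ℝ, E') E' (TangentSpace 𝓘(ℝ, E') : N → Type _))
    (hD : g.IsLeviCivita D)
    (c : ℝ) (hc : g.HasConstantSectionalCurvature D c)
    (i : M → N) (hi : Lightlike.IsLightlikeHypersurface (E := E) g i)
    (S : Lightlike.ScreenDistribution (E := E) g i) :
    (Lightlike.IsTotallyGeodesic g D i S → Lightlike.IsLocallySymmetric g D i S) ∧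
      (c ≠ 0 → (Lightlike.IsLocallySymmetric g D i S ↔ Lightlike.IsTotallyGeodesic g D i S)) :=
  ⟨fun hS ↦ hS.isLocallySymmetric hD hi hc, fun hc0 ↦
    ⟨fun hS ↦ hS.isTotallyGeodesic hD hi hc hc0, fun hS ↦ hS.isLocallySymmetric hD hi hc⟩⟩

theorem proposition5p1
    {E : Type*} [NormedAddCommGroup E] [NormedSpace ℝ E] [FiniteDimensional ℝ E]
    {M : Type*} [TopologicalSpace M] [T2Space M] [SecondCountableTopology M]
    [ChartedSpace E M] [IsManifold 𝓘(ℝ, E) ∞ M]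
    {E' : Type*} [NormedAddCommGroup E'] [NormedSpace ℝ E'] [FiniteDimensional ℝ E']
    {N : Type*} [TopologicalSpace N] [T2Space N] [SecondCountableTopology N]
    [ChartedSpace E' N] [IsManifold 𝓘(ℝ, E') ∞ N]
    (g : Lightlike.SemiRiemannianMetric E' N)
    (D : CovariantDerivative 𝓘(ℝ, E') E' (TangentSpace 𝓘(ℝ, E') : N → Type _))
    (hD : g.IsLeviCivita D)
    (c : ℝ) (hc : g.HasConstantSectionalCurvature D c)
    (i : M → N) (hi : Lightlike.IsLightlikeHypersurface (E := E) g i)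
    (S : Lightlike.ScreenDistribution (E := E) g i) :
    (Lightlike.IsTotallyGeodesic g D i S → Lightlike.IsLocallySymmetric g D i S) ∧
      (c ≠ 0 → (Lightlike.IsLocallySymmetric g D i S ↔ Lightlike.IsTotallyGeodesic g D i S)) := by
  exact proposition5p1_general g D hD c hc i hi S
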